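/- **Setting.** Let $D\ge 1$, let $\mathcal X\subset\mathbb R^D$ be bounded (for instance compact), and let $\|\cdot\|$ be a semi-norm on a vector space $\mathcal C(\mathcal X)$ of bounded measurable functions $g:\mathcal X\to\mathbb R$; put $\|g\|_{\mathcal C}=\|g\|_\infty+\|g\|$. Assume that for every $g\in\mathcal C(\mathcal X)$ one has $e^{g}\in\mathcal C(\mathcal X)$ and $\|e^{g}\|\le\|e^{g}\|_\infty\|g\|$, and that constant functions lie in $\mathcal C(\mathcal X)$ and have semi-norm $0$. Let $(X_i)_{i\ge1}$ be a strictly stationary $\mathcal X$-valued process on a probability space $(\Omega,\mathcal A,\mathbb P)$ which is geometrically C-mixing or geometrically time-reversed C-mixing with parameters $b,\gamma>0$: for every index $i$, every finite set $U$ of indices all smaller than $i$ (time-reversed: all larger than $i$), every $\sigma(X_u:u\in U)$-measurable $\varphi\in L^1(\mathbb P)$ and every $g\in\mathcal C(\mathcal X)$, $$|\mathrm{Cov}(\varphi,g(X_i))|\le e^{-b\,\rho(U,i)^{\gamma}}\,\|\varphi\|_{L^1(\mathbb P)}\,\|g\|_{\mathcal C},\qquad \rho(U,i)=\min_{u\in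 U}|u-i| .$$ Let $X_1$ have Lebesgue density $f:\mathbb R^D\to[0,\infty)$, let $\alpha>0$, and let $K:\mathbb R^D\to\mathbb R$ be non-negative, bounded and Lipschitz (K1). For a bandwidth sequence $(h_N)$ put $$f_N(x)=\frac1{N h_N^{D}}\sum_{i=1}^N K\Big(\frac{X_i-x}{h_N}\Big).$$ Say that K4 holds along $(h_N)$ if for some $\kappa>0$ and all large $N$, for all $x\in\mathbb R^D$, the function $K((\cdot-x)/h_N)$ on $\mathcal X$ lies in $\mathcal C(\mathcal X)$ and has semi-norm at most $N^{\kappa}$. Consider the bandwidths $$h_N^{(1)}=\Big(\frac{(\log N)^{(\gamma+1)/\gamma}}{N}\Big)^{\frac1{2\alpha+D}},\qquad h_N^{(2)}=\Big(\frac{\log N}{N}\Big)^{\frac1{2\alpha+D}} .$$ $Y_N=O_{a.s.}(a_N)$ means that there is a non-random $A$ such that almost surely $Y_N\le A a_N$ for all large $N$; $Y_N=O_p(a_N)$ means that for every $\varepsilon>0$ there is $A$ with $\mathbb P(Y_N>Aa_N)\le\varepsilon$ for all large $N$ (outer probability). **(i)** Suppose $\int\|u\|^\alpha K(u)\,du<\infty$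 and $\int K=1$ (K2), and that $f$ is $\alpha$-Hölder continuous on $\mathbb R^D$. If K4 holds along $h_N=h_N^{(1)}$, then $$\sup_{x\in\mathbb R^D}|f_N(x)-f(x)|=O_{a.s.}\Big(\Big(\frac{(\log N)^{(\gamma+1)/\gamma}}{N}\Big)^{\frac{\alpha}{2\alpha+D}}\Big).$$ If $\gamma>1$ and K4 holds along $h_N=h_N^{(2)}$, then $$\sup_{x\in\mathbb R^D}|f_N(x)-f(x)|=O_{p}\Big(\Big(\frac{\log N}{N}\Big)^{\frac{\alpha}{2\alpha+D}}\Big).$$ **(ii)** Suppose $K$ vanishes outside the ball of radius $M>0$ about $0$ (K3), $\int K=1$, and $f$ is essentially bounded. Suppose $f$ is pointwise $\alpha$-Hölder controllable: there are functions $c,r:\mathbb R^D\to\mathbb R$ such that for almost every $x\in\mathbb R^D$ one has $r(x)>0$ and $$c(x)\ge0\quad\text{and}\quad |f(x+v)-f(x)|\le c(x)\|v\|^\alpha\ \text{ whenever } \|v\|<r(x); \qquad (*)$$ and suppose $(*)$ holds at every $x\in\mathcal X$ (it is void, apart from $c(x)\ge 0$, where $r(x)\le0$, i.e. where no radius exists).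 For $h>0$ put $\mathcal X^\star_h=\{x\in\mathcal X: r(x)>hM\}$ and $\mathcal X^{+hM}=\{x:\inf_{x'\in\mathcal X}\|x-x'\|\le hM\}$. If K4 holds along $h_N=h_N^{(1)}$ and $c$ is bounded on $\mathcal X^\star_{h_N}\cap\mathcal X^{+h_NM}$ by one constant for all large $N$, then $$\sup_{x\in\mathcal X^\star_{h_N}}|f_N(x)-f(x)|=O_{a.s.}\Big(\Big(\frac{(\log N)^{(\gamma+1)/\gamma}}{N}\Big)^{\frac{\alpha}{2\alpha+D}}\Big).$$ If $\gamma>1$ and the same two conditions hold with $h_N=h_N^{(2)}$, then $$\sup_{x\in\mathcal X^\star_{h_N}}|f_N(x)-f(x)|=O_{p}\Big(\Big(\frac{\log N}{N}\Big)^{\frac{\alpha}{2\alpha+D}}\Big).$$ -/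

import Mathlib

open MeasureTheory Filter Topology
open scoped ENNReal

noncomputable section

/-- A vector space of bounded measurable real functions on `Z` carrying a semi-norm: the function
space entering a C-mixing coefficient. Functions outside `carrier` have infinite semi-norm. -/
structure CSpace (Z : Type*) [MeasurableSpace Z] where
  carrier : Submodule ℝ (Z → ℝ)
  measurable_of_mem : ∀ g ∈ carrier, Measurable g
  bounded_of_mem : ∀ g ∈ carrier, ∃ B : ℝ, ∀ z, |g z| ≤ B
  semi : Seminorm ℝ carrier

namespace CSpace

variable {Z : Type*} [MeasurableSpace Z]

/-- The norm `‖g‖_∞ + ‖g‖`. -/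
def cNorm (C : CSpace Z) (g : C.carrier) : ℝ := (⨆ z, |g.1 z|) + C.semi g

/-- `‖exp g‖ ≤ ‖exp g‖_∞ ‖g‖` for all `g` in the space (in particular `exp g` is in the space). -/
def ExpStable (C : CSpace Z) : Prop :=
  ∀ g : C.carrier, ∃ he : (fun z => Real.exp (g.1 z)) ∈ C.carrier,
    C.semi ⟨_, he⟩ ≤ (⨆ z, |Real.exp (g.1 z)|) * C.semi g

/-- Constant functions have semi-norm zero (in particular they are in the space). -/
def ConstNull (C : CSpace Z) : Prop :=
  ∀ a : ℝ, ∃ ha : (fun _ : Z => a) ∈ C.carrier, C.semi ⟨_, ha⟩ = 0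

end CSpace

section Mixing

variable {Ω : Type*} [MeasurableSpace Ω] {Z : Type*} [MeasurableSpace Z]

/-- The law of the whole process is invariant under time shifts. -/
def IsStrictlyStationary (μ : Measure Ω) (X : ℕ → Ω → Z) : Prop :=
  ∀ k : ℕ, μ.map (fun ω i => X (i + k) ω) = μ.map (fun ω i => X i ω)

/-- The geometric covariance bound
`|Cov(φ, g(X_i))| ≤ exp (-b ρ(U,i)^γ) ‖φ‖_{L¹} ‖g‖_C`
for all integrable `φ` measurable with respect to `σ(X_u : u ∈ U)` and all `g` in the function
space, where `ρ(U,i)` is the distance from `i` to `U`. -/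
def GeomCovBound (μ : Measure Ω) (X : ℕ → Ω → Z) (C : CSpace Z) (b γ : ℝ)
    (U : Finset ℕ) (i : ℕ) : Prop :=
  ∀ φ : Ω → ℝ, Measurable[⨆ u ∈ U, MeasurableSpace.comap (X u) inferInstance] φ →
    Integrable φ μ → ∀ g : C.carrier,
      |(∫ ω, φ ω * g.1 (X i ω) ∂μ) - (∫ ω, φ ω ∂μ) * ∫ ω, g.1 (X i ω) ∂μ| ≤
        Real.exp (-b * (Metric.infDist i (U : Set ℕ)) ^ γ) * (∫ ω, |φ ω| ∂μ) * C.cNorm g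

/-- Geometric C-mixing (order `e`), with the covariance bound for all finite index sets at positive
distance, on both sides of `i`. -/
def IsGeomCMixingTwoSided (μ : Measure Ω) (X : ℕ → Ω → Z) (C : CSpace Z) (b γ : ℝ) : Prop :=
  ∀ (U : Finset ℕ) (i : ℕ), i ∉ U → GeomCovBound μ X C b γ U i

/-- Geometric C-mixing (order `e`): only index sets in the past of `i` are tested. -/
def IsGeomCMixing (μ : Measure Ω) (X : ℕ → Ω → Z) (C : CSpace Z) (b γ : ℝ) : Prop :=
  ∀ (U : Finset ℕ) (i : ℕ), (∀ u ∈ U, u < i) → GeomCovBound μ X C b γ U i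

/-- Geometric time-reversed C-mixing (order `e`): only index sets in the future of `i`. -/
def IsGeomTimeReversedCMixing (μ : Measure Ω) (X : ℕ → Ω → Z) (C : CSpace Z) (b γ : ℝ) : Prop :=
  ∀ (U : Finset ℕ) (i : ℕ), (∀ u ∈ U, i < u) → GeomCovBound μ X C b γ U i

theorem IsGeomCMixingTwoSided.isGeomCMixing {μ : Measure Ω} {X : ℕ → Ω → Z} {C : CSpace Z}
    {b γ : ℝ} (h : IsGeomCMixingTwoSided μ X C b γ) : IsGeomCMixing μ X C b γ :=
  fun U i hU => h U i fun hi => lt_irrefl i (hU i hi)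

end Mixing

section Stochastic

variable {Ω : Type*} [MeasurableSpace Ω]

/-- `Y_N = O_{a.s.}(a_N)`, with a non-random constant. -/
def IsBigOAlmostSurely (μ : Measure Ω) (Y : ℕ → Ω → ℝ≥0∞) (a : ℕ → ℝ) : Prop :=
  ∃ A : ℝ, 0 < A ∧ ∀ᵐ ω ∂μ, ∀ᶠ N in atTop, Y N ω ≤ ENNReal.ofReal (A * a N)

/-- `Y_N = O_p(a_N)`. -/
def IsBigOInProbability (μ : Measure Ω) (Y : ℕ → Ω → ℝ≥0∞) (a : ℕ → ℝ) : Prop :=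
  ∀ ε : ℝ≥0∞, 0 < ε → ∃ A : ℝ, 0 < A ∧
    ∀ᶠ N in atTop, μ {ω | ENNReal.ofReal (A * a N) < Y N ω} ≤ ε

end Stochastic

section Kernel

variable {D : ℕ}

/-- The supremum of `|g|` over `S`. -/
def supNormOn (S : Set (EuclideanSpace ℝ (Fin D))) (g : EuclideanSpace ℝ (Fin D) → ℝ) : ℝ≥0∞ :=
  ⨆ x ∈ S, ENNReal.ofReal |g x|

/-- `f` is a Lebesgue density of the random vector `Y`. -/
def IsDensityOf {Ω : Type*} [MeasurableSpace Ω] (μ : Measure Ω)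
    (Y : Ω → EuclideanSpace ℝ (Fin D)) (f : EuclideanSpace ℝ (Fin D) → ℝ) : Prop :=
  Measurable f ∧ (∀ x, 0 ≤ f x) ∧ μ.map Y = volume.withDensity fun x => ENNReal.ofReal (f x)

/-- `f` is `α`-Hölder continuous on the whole space. -/
def IsHolder (α : ℝ) (f : EuclideanSpace ℝ (Fin D) → ℝ) : Prop :=
  ∃ L : ℝ, ∀ x y, |f x - f y| ≤ L * ‖x - y‖ ^ α

/-- The local Hölder control of `f` at the point `x`, with constant `c x` and radius `r x`. -/
def HolderControlAt (α : ℝ) (f c r : EuclideanSpace ℝ (Fin D) → ℝ)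
    (x : EuclideanSpace ℝ (Fin D)) : Prop :=
  0 ≤ c x ∧ ∀ v : EuclideanSpace ℝ (Fin D), ‖v‖ < r x → |f (x + v) - f x| ≤ c x * ‖v‖ ^ α

/-- `f` is pointwise `α`-Hölder controllable, with the functions `c` and `r` as witnesses. -/
def IsPointwiseHolderControllable (α : ℝ) (f c r : EuclideanSpace ℝ (Fin D) → ℝ) : Prop :=
  ∀ᵐ x ∂(volume : Measure (EuclideanSpace ℝ (Fin D))), 0 < r x ∧ HolderControlAt α f c r x

/-- Condition K1: non-negative, bounded, Lipschitz. -/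
def KernelK1 (K : EuclideanSpace ℝ (Fin D) → ℝ) : Prop :=
  (∀ u, 0 ≤ K u) ∧ (∃ B : ℝ, ∀ u, K u ≤ B) ∧ ∃ L : NNReal, LipschitzWith L K

/-- Condition K2: finite moment of order `α`, total integral one. -/
def KernelK2 (α : ℝ) (K : EuclideanSpace ℝ (Fin D) → ℝ) : Prop :=
  Integrable (fun u => ‖u‖ ^ α * K u) ∧ ∫ u, K u = 1

/-- Condition K3: support in the ball of radius `M` around the origin. -/
def KernelK3 (M : ℝ) (K : EuclideanSpace ℝ (Fin D) → ℝ) : Prop :=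
  Function.support K ⊆ Metric.closedBall 0 M

/-- Condition K4 along the bandwidths `h`: for some `κ > 0`, for all large `N`, all the functions
`K((· - x)/h_N)` on `S` are in the function space, with semi-norm at most `N ^ κ`. -/
def KernelK4 {S : Set (EuclideanSpace ℝ (Fin D))} (C : CSpace S)
    (K : EuclideanSpace ℝ (Fin D) → ℝ) (h : ℕ → ℝ) : Prop :=
  ∃ κ : ℝ, 0 < κ ∧ ∀ᶠ N : ℕ in atTop, ∀ x : EuclideanSpace ℝ (Fin D),
    ∃ hK : (fun z : S => K ((h N)⁻¹ • ((z : EuclideanSpace ℝ (Fin D)) - x))) ∈ C.carrier,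
      C.semi ⟨_, hK⟩ ≤ (N : ℝ) ^ κ

/-- The kernel density estimator `(N h^D)⁻¹ ∑ K((X_i - x)/h)` from the first `N` observations. -/
def kernelDensityEstimator {Ω : Type*} {S : Set (EuclideanSpace ℝ (Fin D))} (X : ℕ → Ω → S)
    (K : EuclideanSpace ℝ (Fin D) → ℝ) (h : ℝ) (N : ℕ) (ω : Ω)
    (x : EuclideanSpace ℝ (Fin D)) : ℝ :=
  ((N : ℝ) * h ^ D)⁻¹ *
    ∑ i ∈ Finset.range N, K (h⁻¹ • ((X i ω : EuclideanSpace ℝ (Fin D)) - x))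

/-- The enlargement of `S` by `δ`: all points at distance at most `δ` from `S`. -/
def enlargement (S : Set (EuclideanSpace ℝ (Fin D))) (δ : ℝ) : Set (EuclideanSpace ℝ (Fin D)) :=
  {x | Metric.infDist x S ≤ δ}

/-- The points of `S` at which the control radius exceeds `δ`. -/
def controlledPart (S : Set (EuclideanSpace ℝ (Fin D))) (r : EuclideanSpace ℝ (Fin D) → ℝ)
    (δ : ℝ) : Set (EuclideanSpace ℝ (Fin D)) :=
  {x ∈ S | δ < r x}

/-- `(log N)^p / N`. -/
def logRatio (p : ℝ) (N : ℕ) : ℝ := Real.log N ^ p / N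

/-- The bandwidth `((log N)^p / N)^(1/(2α+D))`. -/
def bandwidth (D : ℕ) (α p : ℝ) (N : ℕ) : ℝ := logRatio p N ^ (1 / (2 * α + D))

/-- The rate `((log N)^p / N)^(α/(2α+D))`. -/
def rate (D : ℕ) (α p : ℝ) (N : ℕ) : ℝ := logRatio p N ^ (α / (2 * α + D))

/-- The random function `f_N - f`, where `f_N` uses the bandwidth `h_N`. -/
def estimationError {Ω : Type*} {S : Set (EuclideanSpace ℝ (Fin D))} (X : ℕ → Ω → S)
    (K f : EuclideanSpace ℝ (Fin D) → ℝ) (h : ℕ → ℝ) (N : ℕ) (ω : Ω)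
    (x : EuclideanSpace ℝ (Fin D)) : ℝ :=
  kernelDensityEstimator X K (h N) N ω x - f x

/-- The control constants `c` are bounded on the controlled parts of `S` at the scales `h_N M`,
with one bound for all large `N`. -/
def ControlConstantBounded (S : Set (EuclideanSpace ℝ (Fin D)))
    (c r : EuclideanSpace ℝ (Fin D) → ℝ) (M : ℝ) (h : ℕ → ℝ) : Prop :=
  ∃ B : ℝ, ∀ᶠ N : ℕ in atTop,
    ∀ x ∈ controlledPart S r (h N * M) ∩ enlargement S (h N * M), c x ≤ B

end Kernel

end

/-! The error splits into a bias and a fluctuation. After a change of variables the mean of `f_N(x)`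
is `∫ K(u) f(x + h u) du`, so Hölder control makes the bias `O(h^α)`, which is the rate. The
fluctuation has to be `O(h^α)` uniformly in `x`, for bandwidths with `N h^(D + 2α) = (log N)^p`.

The kernel at bandwidth `h_N` has semi-norm up to `N^κ`, so the covariance bound is useful only at
lags `L` of order `(log N)^(1/γ)`; hence the blocks of length `L`. Bounding a block sum by its
length would cost a factor `L` in the variance. `BlockMixing.measure_abs_sum_ge_le` avoids this
loss: if the conditional mean at lag `k` is at most `q k` and the sums of `q` stay bounded, a block
has second moment of order `L m` plus `L² m²`, where `m` is the mean of one summand.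

The bounds `q k` come from a change of scale in `KernelK4.exists_dominating`. The kernel at
bandwidth `h_N` is at most a constant times a translate at a coarser bandwidth `h_n`, plus a small
tail. The coarse kernel has semi-norm at most `n^κ`, and `n` is taken of order `min (exp (b k^γ /
(2κ))) (√N)`. The mixing factor `exp (-b k^γ)` then beats `n^κ`, while the mean of the coarse kernel
is still small, so `q k` is of order `exp (-c k^γ) + N^(-c)`. Summed over `k < L` this is bounded.

With exponential parameter `s = h^α` the inequality gives probability at most `4 N^(-(A - G))` for a
deviation `2 A h^α` at one point (`exists_pointwise_deviation`), for every `p ≥ 1`. A grid of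
polynomial size, the Lipschitz property of `K` and its decay far from the data make this uniform in
`x` (`exists_uniform_deviation`). The exceptional probabilities are at most `4 N^(-2)`, so
Borel–Cantelli gives the almost sure rate and their convergence to zero the rate in probability. -/

/-! ### Moments of a single block -/

/-- A non-negative bounded function, measurable for the given sigma-algebra. -/
structure IsTestFunction {Ω : Type*} (𝓖 : MeasurableSpace Ω) (φ : Ω → ℝ) : Prop where
  measurable : Measurable[𝓖] φ
  nonneg : ∀ ω, 0 ≤ φ ω
  bounded : ∃ c : ℝ, ∀ ω, φ ω ≤ c

namespace IsTestFunction

variable {Ω : Type*} {𝓖 𝓖' : MeasurableSpace Ω} {φ ψ : Ω → ℝ}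

theorem mono (h : IsTestFunction 𝓖 φ) (hle : 𝓖 ≤ 𝓖') : IsTestFunction 𝓖' φ :=
  ⟨h.measurable.mono hle le_rfl, h.nonneg, h.bounded⟩

theorem mul (h : IsTestFunction 𝓖 φ) (h' : IsTestFunction 𝓖 ψ) :
    IsTestFunction 𝓖 (fun ω => φ ω * ψ ω) := by
  obtain ⟨c, hc⟩ := h.bounded
  obtain ⟨c', hc'⟩ := h'.bounded
  refine ⟨h.measurable.mul h'.measurable, fun ω => mul_nonneg (h.nonneg ω) (h'.nonneg ω), c * c',
    fun ω => mul_le_mul (hc ω) (hc' ω) (h'.nonneg ω) ((h.nonneg ω).trans (hc ω))⟩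

theorem integrable {mΩ : MeasurableSpace Ω} {μ : Measure Ω} [IsFiniteMeasure μ]
    (h : IsTestFunction mΩ φ) : Integrable φ μ := by
  obtain ⟨c, hc⟩ := h.bounded
  refine Integrable.of_bound h.measurable.aestronglyMeasurable c (ae_of_all _ fun ω => ?_)
  rw [Real.norm_eq_abs, abs_of_nonneg (h.nonneg ω)]
  exact hc ω

theorem integral_nonneg {mΩ : MeasurableSpace Ω} {μ : Measure Ω}
    (h : IsTestFunction mΩ φ) : 0 ≤ ∫ ω, φ ω ∂μ :=
  MeasureTheory.integral_nonneg h.nonneg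

theorem integrable_mul {mΩ : MeasurableSpace Ω} {μ : Measure Ω} [IsFiniteMeasure μ]
    (h : IsTestFunction mΩ φ) {g : Ω → ℝ} (hg : Measurable g) {c : ℝ} (hc : ∀ ω, |g ω| ≤ c) :
    Integrable (fun ω => φ ω * g ω) μ :=
  h.integrable.mul_bdd (c := c) hg.aestronglyMeasurable (ae_of_all _ hc)

end IsTestFunction

/-- Adapted variables `Z i` with values in `[0, B]` which are nearly uncorrelated with the past at
lag `L`, and whose conditional mean at the shorter lags `k` is at most `q k`. -/
structure BlockMixing {Ω : Type*} [mΩ : MeasurableSpace Ω] (μ : Measure Ω)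
    (𝓕 : ℕ → MeasurableSpace Ω) (Z : ℕ → Ω → ℝ) (N L : ℕ) (B m δ : ℝ) (q : ℕ → ℝ) : Prop where
  mono : Monotone 𝓕
  le : ∀ j, 𝓕 j ≤ mΩ
  measurable : ∀ i < N, Measurable[𝓕 (i + 1)] (Z i)
  nonneg : ∀ i ω, 0 ≤ Z i ω
  le_bound : ∀ i ω, Z i ω ≤ B
  mean_nonneg : 0 ≤ m
  mean_le : m ≤ B
  error_nonneg : 0 ≤ δ
  q_nonneg : ∀ k, 0 ≤ q k
  bound_le : B ≤ q 0
  decouple : ∀ i j φ, i < N → j ≤ i - L → IsTestFunction (𝓕 j) φ →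
    |(∫ ω, φ ω * Z i ω ∂μ) - m * ∫ ω, φ ω ∂μ| ≤ δ * ∫ ω, φ ω ∂μ
  short : ∀ i k φ, 1 ≤ k → i + k < N → IsTestFunction (𝓕 (i + 1)) φ →
    ∫ ω, φ ω * Z (i + k) ω ∂μ ≤ q k * ∫ ω, φ ω ∂μ

namespace BlockMixing

variable {Ω : Type*} [mΩ : MeasurableSpace Ω] {μ : Measure Ω} [IsProbabilityMeasure μ]
  {𝓕 : ℕ → MeasurableSpace Ω} {Z : ℕ → Ω → ℝ} {N L : ℕ} {B m δ : ℝ} {q : ℕ → ℝ}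

omit [IsProbabilityMeasure μ] in
theorem isTestFunction (h : BlockMixing μ 𝓕 Z N L B m δ q) {i : ℕ} (hi : i < N) :
    IsTestFunction (𝓕 (i + 1)) (Z i) :=
  ⟨h.measurable i hi, h.nonneg i, B, h.le_bound i⟩

omit [IsProbabilityMeasure μ] in
theorem abs_sub_le (h : BlockMixing μ 𝓕 Z N L B m δ q) (i : ℕ) (ω : Ω) : |Z i ω - m| ≤ B := by
  have := h.nonneg i ω
  have := h.le_bound i ω
  have := h.mean_nonneg
  have := h.mean_le
  exact abs_le.2 ⟨by linarith, by linarith⟩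

omit [IsProbabilityMeasure μ] in
theorem integral_mul_le (h : BlockMixing μ 𝓕 Z N L B m δ q) {i j : ℕ} {φ : Ω → ℝ} (hi : i < N)
    (hj : j ≤ i - L) (hφ : IsTestFunction (𝓕 j) φ) :
    ∫ ω, φ ω * Z i ω ∂μ ≤ (m + δ) * ∫ ω, φ ω ∂μ := by
  have := (abs_le.1 (h.decouple i j φ hi hj hφ)).2
  linarith

/-- Two successive conditionings: `φ * Z i` is itself a test function at time `i + 1`, so the later
factor costs `q k`; then `φ` is at lag `L` from `i`, so the remaining factor costs `m + δ`. For `k =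
0` the first step is the pointwise bound by `q 0`. -/
theorem integral_mul_mul_le (h : BlockMixing μ 𝓕 Z N L B m δ q) {i k j : ℕ} {φ : Ω → ℝ}
    (hi : i + k < N) (hj : j ≤ i - L) (hφ : IsTestFunction (𝓕 j) φ) :
    ∫ ω, φ ω * (Z i ω * Z (i + k) ω) ∂μ ≤ q k * ((m + δ) * ∫ ω, φ ω ∂μ) := by
  have hi' : i < N := by omega
  have hφi : IsTestFunction (𝓕 (i + 1)) (fun ω => φ ω * Z i ω) :=
    (hφ.mono (h.mono (by omega))).mul (h.isTestFunction hi')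
  have hφi' := hφi.mono (h.le _)
  have h1 : ∫ ω, φ ω * (Z i ω * Z (i + k) ω) ∂μ ≤ q k * ∫ ω, φ ω * Z i ω ∂μ := by
    rcases Nat.eq_zero_or_pos k with rfl | hk
    · rw [← integral_const_mul]
      have hZ := (h.isTestFunction hi').mono (h.le _)
      refine integral_mono ?_ (hφi'.integrable.const_mul _) fun ω => ?_
      · exact ((hφ.mono (h.le _)).mul (hZ.mul hZ)).integrable
      · have h1 := h.nonneg i ω
        have h2 := (h.le_bound i ω).trans h.bound_le
        have h3 := hφ.nonneg ω
        calc φ ω * (Z i ω * Z i ω) = (φ ω * Z i ω) * Z i ω := by ring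
          _ ≤ (φ ω * Z i ω) * q 0 := by gcongr
          _ = _ := by ring
    · simpa only [mul_assoc] using h.short i k _ hk hi hφi
  exact h1.trans (mul_le_mul_of_nonneg_left (h.integral_mul_le hi' hj hφ) (h.q_nonneg k))

end BlockMixing

/-- From a fixed index, each distance occurs at most once on the left and once on the right, and all
distances inside the window are below `L`. -/
theorem Finset.sum_dist_le_two_mul_sum_range {q : ℕ → ℝ} (hq : ∀ k, 0 ≤ q k) {L a : ℕ}
    {J : Finset ℕ} (hJ : J ⊆ Finset.Ico a (a + L)) {i : ℕ} (hi : i ∈ J) :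
    ∑ j ∈ J, q (Nat.dist i j) ≤ 2 * ∑ k ∈ Finset.range L, q k := by
  classical
  have key : ∀ T : Finset ℕ, T ⊆ J → Set.InjOn (Nat.dist i) T →
      ∑ j ∈ T, q (Nat.dist i j) ≤ ∑ k ∈ Finset.range L, q k := by
    intro T hT hinj
    rw [← Finset.sum_image (f := q) hinj]
    refine Finset.sum_le_sum_of_subset_of_nonneg (fun k hk => ?_) fun k _ _ => hq k
    obtain ⟨j, hj, rfl⟩ := Finset.mem_image.1 hk
    have h1 := Finset.mem_Ico.1 (hJ (hT hj))
    have h2 := Finset.mem_Ico.1 (hJ hi)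
    rw [Finset.mem_range, Nat.dist]
    omega
  have hsplit := Finset.sum_filter_add_sum_filter_not J (fun j => j ≤ i) (fun j => q (Nat.dist i j))
  have h1 := key (J.filter (fun j => j ≤ i)) (Finset.filter_subset _ _) (by
    intro x hx y hy hxy
    simp only [Finset.coe_filter, Set.mem_ofPred_eq, Nat.dist] at hx hy hxy
    omega)
  have h2 := key (J.filter (fun j => ¬ j ≤ i)) (Finset.filter_subset _ _) (by
    intro x hx y hy hxy
    simp only [Finset.coe_filter, Set.mem_ofPred_eq, Nat.dist] at hx hy hxy
    omega)
  linarith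

namespace BlockMixing

variable {Ω : Type*} [mΩ : MeasurableSpace Ω] {μ : Measure Ω} [IsProbabilityMeasure μ]
  {𝓕 : ℕ → MeasurableSpace Ω} {Z : ℕ → Ω → ℝ} {N L : ℕ} {B m δ : ℝ} {q : ℕ → ℝ}

/-- Expanding the square, the negative cross terms are dropped, since `Z` and `m` are non-negative.
What is left are products `Z i * Z j`, whose `q`-weights sum to at most `2 * Q` in each row, and at
most `L ^ 2` copies of `m ^ 2`. Only second moments of pairs enter, so the order is `L * m` and not
`L ^ 2 * m`. -/
theorem integral_mul_sum_sq_le (h : BlockMixing μ 𝓕 Z N L B m δ q) {Q : ℝ}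
    (hQ : ∑ k ∈ Finset.range L, q k ≤ Q) {a lo : ℕ} {J : Finset ℕ}
    (hJ : J ⊆ Finset.Ico a (a + L)) (hJN : ∀ i ∈ J, i < N) (hlo : ∀ i ∈ J, lo ≤ i - L)
    {φ : Ω → ℝ} (hφ : IsTestFunction (𝓕 lo) φ) :
    ∫ ω, φ ω * (∑ i ∈ J, (Z i ω - m)) ^ 2 ∂μ ≤
      ((L : ℝ) ^ 2 * m ^ 2 + L * (m + δ) * (2 * Q)) * ∫ ω, φ ω ∂μ := by
  have hφ' := hφ.mono (h.le _)
  have hI : 0 ≤ ∫ ω, φ ω ∂μ := hφ'.integral_nonneg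
  have hZ : ∀ i ∈ J, IsTestFunction mΩ (Z i) := fun i hi =>
    (h.isTestFunction (hJN i hi)).mono (h.le _)
  have hm := h.mean_nonneg
  have hmδ : 0 ≤ m + δ := add_nonneg hm h.error_nonneg
  have hcard : (J.card : ℝ) ≤ L := by
    have := Finset.card_le_card hJ
    rw [Nat.card_Ico] at this
    exact_mod_cast (by omega : J.card ≤ L)
  have hQ0 : 0 ≤ Q := (Finset.sum_nonneg fun k _ => h.q_nonneg k).trans hQ
  have hint : ∀ i ∈ J, ∀ j ∈ J, Integrable (fun ω => φ ω * (Z i ω * Z j ω)) μ := fun i hi j hj =>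
    (hφ'.mul ((hZ i hi).mul (hZ j hj))).integrable
  have hpair : ∀ i ∈ J, ∀ j ∈ J, ∫ ω, φ ω * (Z i ω * Z j ω) ∂μ ≤
      q (Nat.dist i j) * ((m + δ) * ∫ ω, φ ω ∂μ) := by
    intro i hi j hj
    rcases le_total i j with hij | hij
    · obtain ⟨k, rfl⟩ := Nat.exists_eq_add_of_le hij
      rw [show Nat.dist i (i + k) = k by rw [Nat.dist]; omega]
      exact h.integral_mul_mul_le (hJN _ hj) (hlo i hi) hφ
    · obtain ⟨k, rfl⟩ := Nat.exists_eq_add_of_le hij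
      rw [show Nat.dist (j + k) j = k by rw [Nat.dist]; omega]
      simp only [mul_comm (Z (j + k) _)]
      exact h.integral_mul_mul_le (hJN _ hi) (hlo j hj) hφ
  calc ∫ ω, φ ω * (∑ i ∈ J, (Z i ω - m)) ^ 2 ∂μ
      ≤ ∫ ω, ∑ i ∈ J, ∑ j ∈ J, (φ ω * (Z i ω * Z j ω) + m ^ 2 * φ ω) ∂μ := by
        refine integral_mono_of_nonneg
          (ae_of_all _ fun ω => mul_nonneg (hφ.nonneg ω) (sq_nonneg _)) ?_ (ae_of_all _ fun ω => ?_)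
        · exact integrable_finsetSum _ fun i hi => integrable_finsetSum _ fun j hj =>
            (hint i hi j hj).add (hφ'.integrable.const_mul _)
        · simp only
          rw [sq, Finset.sum_mul_sum, Finset.mul_sum]
          refine Finset.sum_le_sum fun i _ => ?_
          rw [Finset.mul_sum]
          refine Finset.sum_le_sum fun j _ => ?_
          have h1 := h.nonneg i ω
          have h2 := h.nonneg j ω
          have h3 : (Z i ω - m) * (Z j ω - m) ≤ Z i ω * Z j ω + m ^ 2 := by nlinarith
          have h4 := mul_le_mul_of_nonneg_left h3 (hφ.nonneg ω)
          linarith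
    _ = ∑ i ∈ J, ∑ j ∈ J, ((∫ ω, φ ω * (Z i ω * Z j ω) ∂μ) + m ^ 2 * ∫ ω, φ ω ∂μ) := by
        refine (integral_finsetSum _ fun i hi => integrable_finsetSum _ fun j hj =>
            (hint i hi j hj).add (hφ'.integrable.const_mul _)).trans ?_
        refine Finset.sum_congr rfl fun i hi => ?_
        refine (integral_finsetSum _ fun j hj =>
            (hint i hi j hj).add (hφ'.integrable.const_mul _)).trans ?_
        refine Finset.sum_congr rfl fun j hj => ?_
        refine (integral_add (hint i hi j hj) (hφ'.integrable.const_mul _)).trans ?_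
        rw [integral_const_mul]
    _ ≤ ∑ i ∈ J, ((2 * Q) * ((m + δ) * ∫ ω, φ ω ∂μ) + L * (m ^ 2 * ∫ ω, φ ω ∂μ)) := by
        refine Finset.sum_le_sum fun i hi => ?_
        rw [Finset.sum_add_distrib, Finset.sum_const, nsmul_eq_mul]
        refine add_le_add ((Finset.sum_le_sum (hpair i hi)).trans ?_)
          (mul_le_mul_of_nonneg_right hcard (by positivity))
        rw [← Finset.sum_mul]
        refine mul_le_mul_of_nonneg_right ?_ (by positivity)
        exact (Finset.sum_dist_le_two_mul_sum_range h.q_nonneg hJ hi).trans (by linarith)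
    _ ≤ L * ((2 * Q) * ((m + δ) * ∫ ω, φ ω ∂μ) + L * (m ^ 2 * ∫ ω, φ ω ∂μ)) := by
        rw [Finset.sum_const, nsmul_eq_mul]
        exact mul_le_mul_of_nonneg_right hcard (by positivity)
    _ = _ := by ring

theorem abs_integral_mul_sum_le (h : BlockMixing μ 𝓕 Z N L B m δ q) {lo : ℕ} {J : Finset ℕ}
    (hJL : J.card ≤ L) (hJN : ∀ i ∈ J, i < N) (hlo : ∀ i ∈ J, lo ≤ i - L)
    {φ : Ω → ℝ} (hφ : IsTestFunction (𝓕 lo) φ) :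
    |∫ ω, φ ω * ∑ i ∈ J, (Z i ω - m) ∂μ| ≤ L * δ * ∫ ω, φ ω ∂μ := by
  have hφ' := hφ.mono (h.le _)
  have hint : ∀ i ∈ J, Integrable (fun ω => φ ω * (Z i ω - m)) μ := fun i hi =>
    hφ'.integrable_mul ((((h.isTestFunction (hJN i hi)).mono (h.le _)).measurable).sub_const m)
      (h.abs_sub_le i)
  have hterm : ∀ i ∈ J, |∫ ω, φ ω * (Z i ω - m) ∂μ| ≤ δ * ∫ ω, φ ω ∂μ := by
    intro i hi
    have h1 : ∫ ω, φ ω * (Z i ω - m) ∂μ = (∫ ω, φ ω * Z i ω ∂μ) - m * ∫ ω, φ ω ∂μ := by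
      simp only [mul_sub]
      rw [integral_sub (hφ'.mul ((h.isTestFunction (hJN i hi)).mono (h.le _))).integrable
        (hφ'.integrable.mul_const _), integral_mul_const]
      ring
    rw [h1]
    exact h.decouple i lo φ (hJN i hi) (hlo i hi) hφ
  have h2 : ∫ ω, φ ω * ∑ i ∈ J, (Z i ω - m) ∂μ = ∑ i ∈ J, ∫ ω, φ ω * (Z i ω - m) ∂μ := by
    simp only [Finset.mul_sum]
    exact integral_finsetSum _ hint
  rw [h2]
  refine (Finset.abs_sum_le_sum_abs _ _).trans ((Finset.sum_le_sum hterm).trans ?_)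
  rw [Finset.sum_const, nsmul_eq_mul, mul_assoc]
  have hJL' : (J.card : ℝ) ≤ L := by exact_mod_cast hJL
  exact mul_le_mul_of_nonneg_right hJL' (mul_nonneg h.error_nonneg hφ'.integral_nonneg)

omit [IsProbabilityMeasure μ] in
theorem abs_mul_sum_le_one (h : BlockMixing μ 𝓕 Z N L B m δ q) {J : Finset ℕ}
    (hJL : J.card ≤ L) {s : ℝ} (hs : |s| * (L * B) ≤ 1) (ω : Ω) :
    |s * ∑ i ∈ J, (Z i ω - m)| ≤ 1 := by
  rw [abs_mul]
  refine (mul_le_mul_of_nonneg_left ?_ (abs_nonneg s)).trans hs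
  refine (Finset.abs_sum_le_sum_abs _ _).trans
    ((Finset.sum_le_sum fun i _ => h.abs_sub_le i ω).trans ?_)
  rw [Finset.sum_const, nsmul_eq_mul]
  have hJL' : (J.card : ℝ) ≤ L := by exact_mod_cast hJL
  exact mul_le_mul_of_nonneg_right hJL' (h.mean_nonneg.trans h.mean_le)

omit [IsProbabilityMeasure μ] in
theorem isTestFunction_exp (h : BlockMixing μ 𝓕 Z N L B m δ q) {J : Finset ℕ}
    (hJL : J.card ≤ L) {s : ℝ} (hs : |s| * (L * B) ≤ 1) {hi : ℕ} (hJ : ∀ i ∈ J, i < hi)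
    (hJN : ∀ i ∈ J, i < N) :
    IsTestFunction (𝓕 hi) (fun ω => Real.exp (s * ∑ i ∈ J, (Z i ω - m))) := by
  refine ⟨?_, fun ω => (Real.exp_pos _).le, Real.exp 1, fun ω => Real.exp_le_exp.2
    ((le_abs_self _).trans (h.abs_mul_sum_le_one hJL hs ω))⟩
  refine Real.measurable_exp.comp (Measurable.const_mul ?_ s)
  refine Finset.measurable_sum _ fun i hiJ => Measurable.sub_const ?_ m
  exact (h.measurable i (hJN i hiJ)).mono (h.mono (hJ i hiJ)) le_rfl

/-- The condition on `s` keeps the exponent in `[-1, 1]`, where `exp x ≤ 1 + x + x ^ 2`; the linear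
term is then of the order of the mixing error and the quadratic term is the block variance. -/
theorem integral_mul_exp_le (h : BlockMixing μ 𝓕 Z N L B m δ q) {Q : ℝ}
    (hQ : ∑ k ∈ Finset.range L, q k ≤ Q) {a lo : ℕ} {J : Finset ℕ}
    (hJ : J ⊆ Finset.Ico a (a + L)) (hJN : ∀ i ∈ J, i < N) (hlo : ∀ i ∈ J, lo ≤ i - L)
    {s : ℝ} (hs : |s| * (L * B) ≤ 1) {φ : Ω → ℝ} (hφ : IsTestFunction (𝓕 lo) φ) :
    ∫ ω, φ ω * Real.exp (s * ∑ i ∈ J, (Z i ω - m)) ∂μ ≤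
      (1 + (|s| * (L * δ) + s ^ 2 * ((L : ℝ) ^ 2 * m ^ 2 + L * (m + δ) * (2 * Q)))) *
        ∫ ω, φ ω ∂μ := by
  have hφ' := hφ.mono (h.le _)
  have hJL : J.card ≤ L := by
    have := Finset.card_le_card hJ
    rw [Nat.card_Ico] at this
    omega
  set S : Ω → ℝ := fun ω => ∑ i ∈ J, (Z i ω - m) with hS
  have hSm : Measurable S := Finset.measurable_sum _ fun i hi =>
    ((h.measurable i (hJN i hi)).mono (h.le _) le_rfl).sub_const m
  have hSb : ∀ ω, |S ω| ≤ L * B := by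
    intro ω
    refine (Finset.abs_sum_le_sum_abs _ _).trans
      ((Finset.sum_le_sum fun i _ => h.abs_sub_le i ω).trans ?_)
    rw [Finset.sum_const, nsmul_eq_mul]
    have hJL' : (J.card : ℝ) ≤ L := by exact_mod_cast hJL
    exact mul_le_mul_of_nonneg_right hJL' (h.mean_nonneg.trans h.mean_le)
  have hi1 : Integrable (fun ω => φ ω * S ω) μ := hφ'.integrable_mul hSm hSb
  have hi2 : Integrable (fun ω => φ ω * S ω ^ 2) μ :=
    hφ'.integrable_mul (hSm.pow_const 2) (c := (L * B) ^ 2) fun ω => by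
      rw [abs_pow]; exact pow_le_pow_left₀ (abs_nonneg _) (hSb ω) 2
  have hexp : ∀ ω, Real.exp (s * S ω) ≤ 1 + s * S ω + (s * S ω) ^ 2 := by
    intro ω
    have := (abs_le.1 (Real.abs_exp_sub_one_sub_id_le (h.abs_mul_sum_le_one hJL hs ω))).2
    simp only [hS]
    linarith
  calc ∫ ω, φ ω * Real.exp (s * S ω) ∂μ
      ≤ ∫ ω, (φ ω + s * (φ ω * S ω) + s ^ 2 * (φ ω * S ω ^ 2)) ∂μ := by
        refine integral_mono_of_nonneg
          (ae_of_all _ fun ω => mul_nonneg (hφ.nonneg ω) (Real.exp_pos _).le)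
          ((hφ'.integrable.add (hi1.const_mul s)).add (hi2.const_mul _)) (ae_of_all _ fun ω => ?_)
        have := mul_le_mul_of_nonneg_left (hexp ω) (hφ.nonneg ω)
        simp only
        nlinarith
    _ = (∫ ω, φ ω ∂μ) + s * (∫ ω, φ ω * S ω ∂μ) + s ^ 2 * ∫ ω, φ ω * S ω ^ 2 ∂μ := by
        have e1 := integral_add (hφ'.integrable.add (hi1.const_mul s)) (hi2.const_mul (s ^ 2))
        have e2 := integral_add hφ'.integrable (hi1.const_mul s)
        simp only [Pi.add_apply, integral_const_mul] at e1 e2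
        rw [e1, e2]
    _ ≤ (∫ ω, φ ω ∂μ) + |s| * (L * δ * ∫ ω, φ ω ∂μ) +
          s ^ 2 * (((L : ℝ) ^ 2 * m ^ 2 + L * (m + δ) * (2 * Q)) * ∫ ω, φ ω ∂μ) := by
        refine add_le_add (add_le_add le_rfl ?_) (mul_le_mul_of_nonneg_left
          (h.integral_mul_sum_sq_le hQ hJ hJN hlo hφ) (sq_nonneg s))
        refine (le_abs_self _).trans ?_
        rw [abs_mul]
        exact mul_le_mul_of_nonneg_left (h.abs_integral_mul_sum_le hJL hJN hlo hφ) (abs_nonneg s)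
    _ = _ := by ring

end BlockMixing

/-! ### Alternating blocks and the exponential inequality -/

/-- The indices below `N` whose block of length `L` has number `b`. -/
def indexBlock (N L b : ℕ) : Finset ℕ := (Finset.range N).filter fun i => i / L = b

theorem indexBlock_subset {N L b : ℕ} (hL : 0 < L) :
    indexBlock N L b ⊆ Finset.Ico (b * L) (b * L + L) := by
  intro i hi
  obtain ⟨-, rfl⟩ := Finset.mem_filter.1 hi
  rw [Finset.mem_Ico]
  have h1 := Nat.div_add_mod i L
  have h2 := Nat.mod_lt i hL
  rw [mul_comm] at h1
  omega

theorem lt_of_mem_indexBlock {N L b i : ℕ} (hi : i ∈ indexBlock N L b) : i < N :=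
  Finset.mem_range.1 (Finset.mem_filter.1 hi).1

theorem sum_range_eq_sum_indexBlock {N L : ℕ} (F : ℕ → ℝ) :
    ∑ i ∈ Finset.range N, F i =
      (∑ k ∈ Finset.range (N / L + 1), ∑ i ∈ indexBlock N L (2 * k), F i) +
        ∑ k ∈ Finset.range (N / L + 1), ∑ i ∈ indexBlock N L (2 * k + 1), F i := by
  rw [← Finset.sum_add_distrib]
  have h1 : ∑ i ∈ Finset.range N, F i = ∑ c ∈ Finset.range (2 * (N / L + 1)),
      ∑ i ∈ indexBlock N L c, F i := by
    refine (Finset.sum_fiberwise_of_maps_to (fun i hi => ?_) F).symm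
    have := Nat.div_le_div_right (c := L) (Finset.mem_range.1 hi).le
    rw [Finset.mem_range]
    omega
  rw [h1]
  generalize N / L + 1 = P
  induction P with
  | zero => simp
  | succ P ih =>
    rw [show 2 * (P + 1) = 2 * P + 1 + 1 by ring, Finset.sum_range_succ, Finset.sum_range_succ, ih,
      Finset.sum_range_succ, add_assoc]

namespace BlockMixing

variable {Ω : Type*} [mΩ : MeasurableSpace Ω] {μ : Measure Ω} [IsProbabilityMeasure μ]
  {𝓕 : ℕ → MeasurableSpace Ω} {Z : ℕ → Ω → ℝ} {N L : ℕ} {B m δ : ℝ} {q : ℕ → ℝ}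

/-- Blocks of equal parity are separated by a full block of length `L`, so the exponential over the
earlier blocks is an admissible test function for the next one, and each block contributes one
factor. Measurability is carried in the same induction because it is what the next step needs. For
`P = 0` and `e = 0` the time index truncates to `0`, harmlessly, since the function is constant. -/
theorem isTestFunction_and_integral_exp_blocks_le (h : BlockMixing μ 𝓕 Z N L B m δ q) (hL : 0 < L)
    {Q : ℝ} (hQ : ∑ k ∈ Finset.range L, q k ≤ Q) {s : ℝ} (hs : |s| * (L * B) ≤ 1) (e P : ℕ) :
    IsTestFunction (𝓕 ((2 * P + e - 1) * L))
      (fun ω => Real.exp (s * ∑ k ∈ Finset.range P, ∑ i ∈ indexBlock N L (2 * k + e),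
        (Z i ω - m))) ∧
    ∫ ω, Real.exp (s * ∑ k ∈ Finset.range P, ∑ i ∈ indexBlock N L (2 * k + e), (Z i ω - m)) ∂μ ≤
      (1 + (|s| * (L * δ) + s ^ 2 * ((L : ℝ) ^ 2 * m ^ 2 + L * (m + δ) * (2 * Q)))) ^ P := by
  have hQ0 : 0 ≤ Q := (Finset.sum_nonneg fun k _ => h.q_nonneg k).trans hQ
  have hη : 0 ≤ 1 + (|s| * (L * δ) + s ^ 2 * ((L : ℝ) ^ 2 * m ^ 2 + L * (m + δ) * (2 * Q))) := by
    have := h.mean_nonneg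
    have := h.error_nonneg
    positivity
  induction P with
  | zero =>
    refine ⟨?_, by simp⟩
    simp only [Finset.range_zero, Finset.sum_empty, mul_zero, Real.exp_zero]
    exact ⟨measurable_const, fun _ => zero_le_one, 1, fun _ => le_rfl⟩
  | succ P ih =>
    obtain ⟨ih1, ih2⟩ := ih
    simp only [Finset.sum_range_succ, mul_add s, Real.exp_add]
    have hsub := indexBlock_subset (N := N) (b := 2 * P + e) hL
    have hcard : (indexBlock N L (2 * P + e)).card ≤ L := by
      have := Finset.card_le_card hsub
      rw [Nat.card_Ico] at this
      omega
    constructor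
    · refine (ih1.mono (h.mono (Nat.mul_le_mul_right L (by omega)))).mul
        (h.isTestFunction_exp hcard hs (fun i hi => ?_) fun i hi => lt_of_mem_indexBlock hi)
      have h1 := (Finset.mem_Ico.1 (hsub hi)).2
      have h2 : (2 * (P + 1) + e - 1) * L = (2 * P + e) * L + L := by
        rw [show 2 * (P + 1) + e - 1 = (2 * P + e) + 1 by omega]; ring
      omega
    · refine (h.integral_mul_exp_le hQ hsub (fun i hi => lt_of_mem_indexBlock hi)
        (fun i hi => ?_) hs ih1).trans ?_
      · have h1 := (Finset.mem_Ico.1 (hsub hi)).1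
        rw [Nat.sub_mul]
        omega
      · rw [pow_succ' _ P]
        exact mul_le_mul_of_nonneg_left ih2 hη

/-- Exponential inequality for the sums over every second block. -/
theorem measure_blocks_ge_le (h : BlockMixing μ 𝓕 Z N L B m δ q) (hL : 0 < L)
    {Q : ℝ} (hQ : ∑ k ∈ Finset.range L, q k ≤ Q) {s : ℝ} (hs0 : 0 ≤ s) (hs : s * (L * B) ≤ 1)
    {σ : ℝ} (hσ : |σ| = 1) (e P : ℕ) (a : ℝ) :
    μ.real {ω | a ≤ σ * ∑ k ∈ Finset.range P, ∑ i ∈ indexBlock N L (2 * k + e), (Z i ω - m)} ≤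
      Real.exp (-(s * a) +
        P * (s * (L * δ) + s ^ 2 * ((L : ℝ) ^ 2 * m ^ 2 + L * (m + δ) * (2 * Q)))) := by
  have hQ0 : 0 ≤ Q := (Finset.sum_nonneg fun k _ => h.q_nonneg k).trans hQ
  have habs : |s * σ| = s := by rw [abs_mul, hσ, mul_one, abs_of_nonneg hs0]
  have hsq : (s * σ) ^ 2 = s ^ 2 := by rw [← sq_abs, habs]
  obtain ⟨h1, h2⟩ := h.isTestFunction_and_integral_exp_blocks_le hL hQ (s := s * σ)
    (by rwa [habs]) e P
  rw [habs, hsq] at h2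
  simp only [mul_assoc s σ] at h1 h2
  refine (ProbabilityTheory.measure_ge_le_exp_mul_mgf a hs0 (h1.mono (h.le _)).integrable).trans ?_
  rw [Real.exp_add, neg_mul]
  refine mul_le_mul_of_nonneg_left (h2.trans ?_) (Real.exp_pos _).le
  rw [Real.exp_nat_mul]
  refine pow_le_pow_left₀ ?_ (by rw [add_comm]; exact Real.add_one_le_exp _) P
  have := h.mean_nonneg
  have := h.error_nonneg
  positivity

/-- Bernstein-type inequality: no loss of a power of the block length in the variance term. -/
theorem measure_abs_sum_ge_le (h : BlockMixing μ 𝓕 Z N L B m δ q) (hL : 0 < L) (hLN : L ≤ N)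
    {Q : ℝ} (hQ : ∑ k ∈ Finset.range L, q k ≤ Q) {s : ℝ} (hs0 : 0 ≤ s) (hs : s * (L * B) ≤ 1)
    (a : ℝ) :
    μ.real {ω | 2 * a ≤ |∑ i ∈ Finset.range N, (Z i ω - m)|} ≤
      4 * Real.exp (-(s * a) + 2 * N * (s * δ + s ^ 2 * (L * m ^ 2 + (m + δ) * (2 * Q)))) := by
  set P := N / L + 1 with hP
  set E := Real.exp (-(s * a) + 2 * N * (s * δ + s ^ 2 * (L * m ^ 2 + (m + δ) * (2 * Q)))) with hE
  have hQ0 : 0 ≤ Q := (Finset.sum_nonneg fun k _ => h.q_nonneg k).trans hQ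
  have hm := h.mean_nonneg
  have hδ := h.error_nonneg
  let A : ℝ → ℕ → Set Ω := fun σ e =>
    {ω | a ≤ σ * ∑ k ∈ Finset.range P, ∑ i ∈ indexBlock N L (2 * k + e), (Z i ω - m)}
  have hA : ∀ σ : ℝ, |σ| = 1 → ∀ e, μ.real (A σ e) ≤ E := by
    intro σ hσ e
    refine (h.measure_blocks_ge_le hL hQ hs0 hs hσ e P a).trans (Real.exp_le_exp.2 ?_)
    -- The extra block in `P` is paid for by `L ≤ N`.
    have hPL : (P : ℝ) * L ≤ 2 * N := by
      have h1 : N / L * L ≤ N := Nat.div_mul_le_self N L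
      have h2 : P * L ≤ 2 * N := by rw [hP, add_mul, one_mul]; omega
      exact_mod_cast h2
    have h3 : 0 ≤ s * δ + s ^ 2 * (L * m ^ 2 + (m + δ) * (2 * Q)) := by positivity
    have h4 := mul_le_mul_of_nonneg_right hPL h3
    linarith
  have hsub : {ω | 2 * a ≤ |∑ i ∈ Finset.range N, (Z i ω - m)|} ⊆
      (A 1 0 ∪ A 1 1) ∪ (A (-1) 0 ∪ A (-1) 1) := by
    intro ω hω
    simp only [Set.mem_ofPred_eq] at hω
    rw [sum_range_eq_sum_indexBlock (L := L)] at hω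
    simp only [A, Set.mem_union, Set.mem_ofPred_eq, add_zero]
    by_contra hcon
    push Not at hcon
    have : |(∑ k ∈ Finset.range P, ∑ i ∈ indexBlock N L (2 * k), (Z i ω - m)) +
        ∑ k ∈ Finset.range P, ∑ i ∈ indexBlock N L (2 * k + 1), (Z i ω - m)| < 2 * a :=
      abs_lt.2 ⟨by linarith [hcon.2.1, hcon.2.2], by linarith [hcon.1.1, hcon.1.2]⟩
    linarith
  calc μ.real {ω | 2 * a ≤ |∑ i ∈ Finset.range N, (Z i ω - m)|}
      ≤ μ.real ((A 1 0 ∪ A 1 1) ∪ (A (-1) 0 ∪ A (-1) 1)) := measureReal_mono hsub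
    _ ≤ (μ.real (A 1 0) + μ.real (A 1 1)) + (μ.real (A (-1) 0) + μ.real (A (-1) 1)) :=
        (measureReal_union_le _ _).trans
          (add_le_add (measureReal_union_le _ _) (measureReal_union_le _ _))
    _ ≤ (E + E) + (E + E) := add_le_add
        (add_le_add (hA 1 (by simp) 0) (hA 1 (by simp) 1))
        (add_le_add (hA (-1) (by simp) 0) (hA (-1) (by simp) 1))
    _ = 4 * E := by ring

end BlockMixing

/-! ### From C-mixing to block mixing -/

section Decoupling

variable {Ω : Type*} [mΩ : MeasurableSpace Ω] {Z : Type*} [MeasurableSpace Z]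

/-- The sigma-algebra generated by the first `j` variables. -/
abbrev pastAlgebra (Y : ℕ → Ω → Z) (j : ℕ) : MeasurableSpace Ω :=
  ⨆ u ∈ Finset.range j, MeasurableSpace.comap (Y u) inferInstance

omit mΩ in
theorem pastAlgebra_mono (Y : ℕ → Ω → Z) : Monotone (pastAlgebra Y) := fun _ _ hij =>
  biSup_mono fun _ hu => Finset.range_mono hij hu

theorem pastAlgebra_le {Y : ℕ → Ω → Z} (hY : ∀ i, Measurable (Y i)) (j : ℕ) :
    pastAlgebra Y j ≤ mΩ :=
  iSup₂_le fun u _ => (hY u).comap_le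

omit mΩ in
theorem measurable_pastAlgebra {Y : ℕ → Ω → Z} {i j : ℕ} (hij : i < j) :
    Measurable[pastAlgebra Y j] (Y i) :=
  (comap_measurable (Y i)).mono
    (le_iSup₂_of_le (f := fun u (_ : u ∈ Finset.range j) => MeasurableSpace.comap (Y u) _) i
      (Finset.mem_range.2 hij) le_rfl) le_rfl

theorem CSpace.cNorm_nonneg (C : CSpace Z) (g : C.carrier) : 0 ≤ C.cNorm g :=
  add_nonneg (Real.iSup_nonneg fun _ => abs_nonneg _) (apply_nonneg _ _)

/-- Each of the first `N` variables is decoupled from the past, geometrically in the lag. -/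
def PastDecoupled (μ : Measure Ω) (Y : ℕ → Ω → Z) (C : CSpace Z) (b γ : ℝ) (N : ℕ) : Prop :=
  ∀ i < N, ∀ k, 1 ≤ k → ∀ φ, IsTestFunction (pastAlgebra Y (i + 1 - k)) φ → ∀ g : C.carrier,
    |(∫ ω, φ ω * g.1 (Y i ω) ∂μ) - (∫ ω, φ ω ∂μ) * ∫ ω, g.1 (Y i ω) ∂μ| ≤
      Real.exp (-b * (k : ℝ) ^ γ) * (∫ ω, φ ω ∂μ) * C.cNorm g

theorem abs_cov_le_of_measurable_bot {μ : Measure Ω} [IsProbabilityMeasure μ] {φ g : Ω → ℝ}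
    (hφ : Measurable[⊥] φ) : (∫ ω, φ ω * g ω ∂μ) - (∫ ω, φ ω ∂μ) * ∫ ω, g ω ∂μ = 0 := by
  obtain ⟨ω₀⟩ : Nonempty Ω := nonempty_of_isProbabilityMeasure μ
  have hconst : ∀ ω, φ ω = φ ω₀ := by
    intro ω
    have h1 : MeasurableSet[⊥] (φ ⁻¹' {φ ω₀}) := hφ (measurableSet_singleton _)
    rcases MeasurableSpace.measurableSet_bot_iff.1 h1 with h | h
    · exact absurd (show ω₀ ∈ φ ⁻¹' {φ ω₀} from rfl) (by simp [h])
    · exact (show ω ∈ φ ⁻¹' {φ ω₀} by rw [h]; trivial)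
  simp only [hconst, integral_const_mul, integral_const, probReal_univ, one_smul, sub_self]

theorem GeomCovBound.abs_cov_le {μ : Measure Ω} [IsProbabilityMeasure μ] {X : ℕ → Ω → Z}
    (hX : ∀ i, Measurable (X i)) {C : CSpace Z} {b γ : ℝ} (hb : 0 < b) (hγ : 0 < γ) {U : Finset ℕ}
    {i k : ℕ} (h : GeomCovBound μ X C b γ U i) (hk : ∀ u ∈ U, (k : ℝ) ≤ |(i : ℝ) - u|) {φ : Ω → ℝ}
    (hφ : IsTestFunction (⨆ u ∈ U, MeasurableSpace.comap (X u) inferInstance) φ)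
    (g : C.carrier) :
    |(∫ ω, φ ω * g.1 (X i ω) ∂μ) - (∫ ω, φ ω ∂μ) * ∫ ω, g.1 (X i ω) ∂μ| ≤
      Real.exp (-b * (k : ℝ) ^ γ) * (∫ ω, φ ω ∂μ) * C.cNorm g := by
  have hφ' : IsTestFunction mΩ φ := hφ.mono (iSup₂_le fun u _ => (hX u).comap_le)
  have hI := hφ'.integral_nonneg (μ := μ)
  have hg := C.cNorm_nonneg g
  -- For empty `U` the distance `Metric.infDist` is `0` by convention, so the mixing bound carries
  -- no decay; but `φ` is then constant and the covariance vanishes.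
  rcases U.eq_empty_or_nonempty with rfl | hU
  · rw [abs_cov_le_of_measurable_bot (hφ.measurable.mono (by simp) le_rfl), abs_zero]
    positivity
  · refine (h φ hφ.measurable hφ'.integrable g).trans ?_
    have hd : (k : ℝ) ≤ Metric.infDist i (U : Set ℕ) :=
      (Metric.le_infDist (Finset.coe_nonempty.2 hU)).2 fun u hu => by
        rw [Nat.dist_eq]; exact hk u hu
    simp only [abs_of_nonneg (hφ.nonneg _)]
    have h1 : (k : ℝ) ^ γ ≤ (Metric.infDist i (U : Set ℕ)) ^ γ :=
      Real.rpow_le_rpow (Nat.cast_nonneg k) hd hγ.le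
    have h2 : -b * (Metric.infDist i (U : Set ℕ)) ^ γ ≤ -b * (k : ℝ) ^ γ := by nlinarith
    gcongr

theorem IsGeomCMixing.pastDecoupled {μ : Measure Ω} [IsProbabilityMeasure μ] {X : ℕ → Ω → Z}
    (hX : ∀ i, Measurable (X i)) {C : CSpace Z} {b γ : ℝ} (hb : 0 < b) (hγ : 0 < γ)
    (h : IsGeomCMixing μ X C b γ) (N : ℕ) : PastDecoupled μ X C b γ N := by
  intro i _ k hk φ hφ g
  have hU : ∀ u ∈ Finset.range (i + 1 - k), u < i := fun u hu => by
    have := Finset.mem_range.1 hu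
    omega
  refine (h _ i hU).abs_cov_le hX hb hγ (fun u hu => ?_) hφ g
  have h1 := Finset.mem_range.1 hu
  have h2 : ((k + u : ℕ) : ℝ) ≤ i := by exact_mod_cast (by omega : k + u ≤ i)
  push_cast at h2
  exact le_abs.2 (Or.inl (by linarith))

/-- Reading the first `N` observations backwards turns the future into the past. This suffices
because the estimator depends only on their sum. -/
theorem IsGeomTimeReversedCMixing.pastDecoupled {μ : Measure Ω} [IsProbabilityMeasure μ]
    {X : ℕ → Ω → Z} (hX : ∀ i, Measurable (X i)) {C : CSpace Z} {b γ : ℝ} (hb : 0 < b)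
    (hγ : 0 < γ) (h : IsGeomTimeReversedCMixing μ X C b γ) (N : ℕ) :
    PastDecoupled μ (fun i => X (N - 1 - i)) C b γ N := by
  intro i hi k hk φ hφ g
  have hU : ∀ u ∈ (Finset.range (i + 1 - k)).image (fun u => N - 1 - u), N - 1 - i < u := by
    intro u hu
    obtain ⟨v, hv, rfl⟩ := Finset.mem_image.1 hu
    have := Finset.mem_range.1 hv
    omega
  refine (h _ _ hU).abs_cov_le hX hb hγ (fun u hu => ?_) ?_ g
  · obtain ⟨v, hv, rfl⟩ := Finset.mem_image.1 hu
    have h1 := Finset.mem_range.1 hv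
    have h2 : ((N - 1 - i + k : ℕ) : ℝ) ≤ (N - 1 - v : ℕ) := by
      exact_mod_cast (by omega : N - 1 - i + k ≤ N - 1 - v)
    rw [Nat.cast_add] at h2
    exact le_abs.2 (Or.inr (by linarith))
  · rw [Finset.iSup_finset_image]
    exact hφ

theorem IsStrictlyStationary.map_eq {μ : Measure Ω} {X : ℕ → Ω → Z} (h : IsStrictlyStationary μ X)
    (hX : ∀ i, Measurable (X i)) (i : ℕ) : μ.map (X i) = μ.map (X 0) := by
  have h1 := congrArg (fun ν => Measure.map (fun x : ℕ → Z => x 0) ν) (h i)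
  rw [Measure.map_map (measurable_pi_apply 0) (measurable_pi_lambda _ fun j => hX _),
    Measure.map_map (measurable_pi_apply 0) (measurable_pi_lambda _ fun j => hX _)] at h1
  simpa [Function.comp_def] using h1

/-- A process decoupled from its past yields a block mixing sequence of real variables. -/
theorem PastDecoupled.blockMixing {μ : Measure Ω} [IsProbabilityMeasure μ] {Y : ℕ → Ω → Z}
    (hY : ∀ i, Measurable (Y i)) {C : CSpace Z} {b γ : ℝ} {N L : ℕ}
    (h : PastDecoupled μ Y C b γ N) {ν : Measure Z} (hν : ∀ i, μ.map (Y i) = ν) (hL : 1 ≤ L)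
    {W : C.carrier} {B δ : ℝ} (hW0 : ∀ z, 0 ≤ W.1 z) (hWB : ∀ z, W.1 z ≤ B)
    (hδ : Real.exp (-b * (L : ℝ) ^ γ) * C.cNorm W ≤ δ) {q : ℕ → ℝ} (hq : ∀ k, 0 ≤ q k)
    (hqB : B ≤ q 0)
    (hdom : ∀ k : ℕ, 1 ≤ k → ∃ (a e : ℝ) (g : C.carrier), 0 ≤ a ∧ 0 ≤ e ∧
      (∀ z, W.1 z ≤ a * g.1 z + e) ∧
      a * ((∫ z, g.1 z ∂ν) + Real.exp (-b * (k : ℝ) ^ γ) * C.cNorm g) + e ≤ q k) :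
    BlockMixing μ (pastAlgebra Y) (fun i ω => W.1 (Y i ω)) N L B (∫ z, W.1 z ∂ν) δ q := by
  have hνp : IsProbabilityMeasure ν := by
    rw [← hν 0]; exact Measure.isProbabilityMeasure_map (hY 0).aemeasurable
  have hlaw : ∀ (g : C.carrier) i, ∫ ω, g.1 (Y i ω) ∂μ = ∫ z, g.1 z ∂ν := fun g i => by
    rw [← hν i, integral_map (hY i).aemeasurable
      (C.measurable_of_mem _ g.2).aestronglyMeasurable]
  have hWint : Integrable W.1 ν := Integrable.of_bound
    (C.measurable_of_mem _ W.2).aestronglyMeasurable B (ae_of_all _ fun z => by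
      rw [Real.norm_eq_abs, abs_of_nonneg (hW0 z)]; exact hWB z)
  have hle := pastAlgebra_le hY
  refine ⟨pastAlgebra_mono Y, hle, fun i _ => ?_, fun i ω => hW0 _,
    fun i ω => hWB _, integral_nonneg hW0, ?_, ?_, hq, hqB, ?_, ?_⟩
  · exact (C.measurable_of_mem _ W.2).comp (measurable_pastAlgebra (Nat.lt_succ_self i))
  · calc ∫ z, W.1 z ∂ν ≤ ∫ _, B ∂ν := integral_mono hWint (integrable_const B) hWB
      _ = B := by simp
  · exact (mul_nonneg (Real.exp_pos _).le (C.cNorm_nonneg W)).trans hδ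
  · intro i j φ hi hj hφ
    -- The lag-`L` past of `i` consists of the indices `u ≤ i - L`, hence the shift by one; for `i <
    -- L` both sides truncate to `0`.
    have hφ1 := hφ.mono (pastAlgebra_mono Y (show j ≤ i + 1 - L by omega))
    have hI := (hφ.mono (hle _)).integral_nonneg (μ := μ)
    have h1 := h i hi L hL φ hφ1 W
    rw [hlaw, mul_comm (∫ ω, φ ω ∂μ) (∫ z, W.1 z ∂ν)] at h1
    refine h1.trans ?_
    rw [mul_right_comm]
    exact mul_le_mul_of_nonneg_right hδ hI
  · intro i k φ hk hi hφ
    obtain ⟨a, e, g, ha, he, hWg, hgq⟩ := hdom k hk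
    have hφ' := hφ.mono (hle _)
    have hI := hφ'.integral_nonneg (μ := μ)
    have h1 := h (i + k) hi k hk φ (by rwa [show i + k + 1 - k = i + 1 by omega]) g
    rw [hlaw] at h1
    have h2 := (abs_le.1 h1).2
    obtain ⟨c, hc⟩ := C.bounded_of_mem _ g.2
    have hgi : Integrable (fun ω => φ ω * g.1 (Y (i + k) ω)) μ :=
      hφ'.integrable_mul ((C.measurable_of_mem _ g.2).comp (hY _)) fun ω => hc _
    calc ∫ ω, φ ω * W.1 (Y (i + k) ω) ∂μ
        ≤ ∫ ω, (a * (φ ω * g.1 (Y (i + k) ω)) + e * φ ω) ∂μ := by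
          refine integral_mono_of_nonneg
            (ae_of_all _ fun ω => mul_nonneg (hφ.nonneg ω) (hW0 _))
            ((hgi.const_mul a).add (hφ'.integrable.const_mul e)) (ae_of_all _ fun ω => ?_)
          have := mul_le_mul_of_nonneg_left (hWg (Y (i + k) ω)) (hφ.nonneg ω)
          simp only
          linarith
      _ = a * (∫ ω, φ ω * g.1 (Y (i + k) ω) ∂μ) + e * ∫ ω, φ ω ∂μ := by
          refine (integral_add (hgi.const_mul a) (hφ'.integrable.const_mul e)).trans ?_
          rw [integral_const_mul, integral_const_mul]
      _ ≤ a * ((∫ ω, φ ω ∂μ) * (∫ z, g.1 z ∂ν) +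
            Real.exp (-b * (k : ℝ) ^ γ) * (∫ ω, φ ω ∂μ) * C.cNorm g) + e * ∫ ω, φ ω ∂μ := by
          gcongr
          linarith
      _ = (a * ((∫ z, g.1 z ∂ν) + Real.exp (-b * (k : ℝ) ^ γ) * C.cNorm g) + e) *
            ∫ ω, φ ω ∂μ := by ring
      _ ≤ q k * ∫ ω, φ ω ∂μ := mul_le_mul_of_nonneg_right hgq hI

end Decoupling

/-! ### Bias, boundedness of the density and decay of the kernel -/

section KernelFacts

variable {D : ℕ}

local notation "𝔼" => EuclideanSpace ℝ (Fin D)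

theorem KernelK1.continuous {K : 𝔼 → ℝ} (hK : KernelK1 K) : Continuous K := by
  obtain ⟨-, -, L, hL⟩ := hK
  exact hL.continuous

theorem KernelK1.exists_ball_le {K : 𝔼 → ℝ} (hK : KernelK1 K) (h1 : ∫ u, K u = 1) :
    ∃ (u₀ : 𝔼) (ρ η : ℝ), 0 < ρ ∧ 0 < η ∧ ∀ u, ‖u - u₀‖ ≤ ρ → η ≤ K u := by
  obtain ⟨u₀, hu₀⟩ : ∃ u₀, 0 < K u₀ := by
    by_contra! h
    have : ∫ u, K u = 0 := by
      rw [← integral_zero 𝔼 ℝ]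
      exact integral_congr_ae (ae_of_all _ fun u => le_antisymm (h u) (hK.1 u))
    linarith
  have hev : ∀ᶠ u in 𝓝 u₀, K u₀ / 2 < K u :=
    hK.continuous.continuousAt.eventually_const_lt (by linarith)
  obtain ⟨ρ, hρ, hball⟩ := Metric.eventually_nhds_iff.1 hev
  refine ⟨u₀, ρ / 2, K u₀ / 2, by positivity, by positivity, fun u hu => (hball ?_).le⟩
  rw [dist_eq_norm]
  linarith

theorem integral_comp_inv_smul_sub (G : 𝔼 → ℝ) {h : ℝ} (hh : 0 < h) (x : 𝔼) :
    ∫ z, G (h⁻¹ • (z - x)) = h ^ D * ∫ u, G u := by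
  rw [integral_sub_right_eq_self (fun z => G (h⁻¹ • z)) x, Measure.integral_comp_smul,
    finrank_euclideanSpace_fin, inv_pow, inv_inv, abs_of_pos (by positivity), smul_eq_mul]

theorem IsDensityOf.integral_comp {Ω : Type*} [MeasurableSpace Ω] {μ : Measure Ω} {Y : Ω → 𝔼}
    {f : 𝔼 → ℝ} (hf : IsDensityOf μ Y f) (hY : Measurable Y) {G : 𝔼 → ℝ} (hG : Measurable G) :
    ∫ ω, G (Y ω) ∂μ = ∫ z, f z * G z := by
  rw [← integral_map (f := G) hY.aemeasurable hG.aestronglyMeasurable, hf.2.2,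
    integral_withDensity_eq_integral_toReal_smul hf.1.ennreal_ofReal
      (ae_of_all _ fun _ => ENNReal.ofReal_lt_top)]
  simp only [ENNReal.toReal_ofReal (hf.2.1 _), smul_eq_mul]

theorem IsDensityOf.integral_kernel {Ω : Type*} [MeasurableSpace Ω] {μ : Measure Ω} {Y : Ω → 𝔼}
    {f : 𝔼 → ℝ} (hf : IsDensityOf μ Y f) (hY : Measurable Y) {K : 𝔼 → ℝ} (hK : KernelK1 K)
    {h : ℝ} (hh : 0 < h) (x : 𝔼) :
    ∫ ω, K (h⁻¹ • (Y ω - x)) ∂μ = h ^ D * ∫ u, K u * f (x + h • u) := by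
  have hKm := hK.continuous.measurable
  rw [hf.integral_comp hY (G := fun z => K (h⁻¹ • (z - x))) (by fun_prop),
    ← integral_comp_inv_smul_sub _ hh x]
  refine integral_congr_ae (ae_of_all _ fun z => ?_)
  simp only [smul_inv_smul₀ hh.ne', add_sub_cancel, mul_comm]

theorem IsDensityOf.integral_kernel_le {Ω : Type*} [MeasurableSpace Ω] {μ : Measure Ω}
    {Y : Ω → 𝔼} {f : 𝔼 → ℝ} (hf : IsDensityOf μ Y f) (hY : Measurable Y) {K : 𝔼 → ℝ}
    (hK : KernelK1 K) (hK1 : ∫ u, K u = 1) {F : ℝ} (hF : ∀ᵐ x, f x ≤ F) {h : ℝ} (hh : 0 < h)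
    (x : 𝔼) : ∫ ω, K (h⁻¹ • (Y ω - x)) ∂μ ≤ F * h ^ D := by
  have hKm := hK.continuous.measurable
  rw [hf.integral_comp hY (G := fun z => K (h⁻¹ • (z - x))) (by fun_prop)]
  have hi : Integrable (fun z => K (h⁻¹ • (z - x))) :=
    ((integrable_of_integral_eq_one hK1).comp_smul (inv_ne_zero hh.ne')).comp_sub_right x
  calc ∫ z, f z * K (h⁻¹ • (z - x)) ≤ ∫ z, F * K (h⁻¹ • (z - x)) := by
        refine integral_mono_of_nonneg (ae_of_all _ fun z => mul_nonneg (hf.2.1 z) (hK.1 _))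
          (hi.const_mul F) (hF.mono fun z hz => ?_)
        exact mul_le_mul_of_nonneg_right hz (hK.1 _)
    _ = F * h ^ D := by
        rw [integral_const_mul, integral_comp_inv_smul_sub _ hh x, hK1, mul_one]

theorem abs_integral_kernel_sub_le {f K G : 𝔼 → ℝ} (hf : Measurable f) (hK : Measurable K)
    (hK1 : ∫ u, K u = 1) {h : ℝ} {x : 𝔼} (hG : Integrable G)
    (hle : ∀ u, |K u * (f (x + h • u) - f x)| ≤ G u) :
    |(∫ u, K u * f (x + h • u)) - f x| ≤ ∫ u, G u := by
  have hi : Integrable (fun u => K u * (f (x + h • u) - f x)) :=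
    hG.mono' (by fun_prop) (ae_of_all _ hle)
  have hKi := (integrable_of_integral_eq_one hK1).mul_const (f x)
  have h1 : ∫ u, K u * f (x + h • u) = (∫ u, K u * (f (x + h • u) - f x)) + f x := by
    calc ∫ u, K u * f (x + h • u) = ∫ u, (K u * (f (x + h • u) - f x) + K u * f x) :=
          integral_congr_ae (ae_of_all _ fun u => by ring)
      _ = (∫ u, K u * (f (x + h • u) - f x)) + ∫ u, K u * f x := integral_add hi hKi
      _ = _ := by rw [integral_mul_const, hK1, one_mul]
  rw [h1, add_sub_cancel_right]
  exact (norm_integral_le_integral_norm _).trans (integral_mono hi.norm hG hle)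

theorem IsHolder.exists_bias_le {α : ℝ} {f K : 𝔼 → ℝ} (hf : IsHolder α f) (hfm : Measurable f)
    (hK : KernelK1 K) (hK2 : KernelK2 α K) :
    ∃ A : ℝ, ∀ (h : ℝ) (x : 𝔼), 0 < h → |(∫ u, K u * f (x + h • u)) - f x| ≤ A * h ^ α := by
  obtain ⟨L, hL⟩ := hf
  refine ⟨L * ∫ u, ‖u‖ ^ α * K u, fun h x hh => ?_⟩
  refine (abs_integral_kernel_sub_le (G := fun u => L * h ^ α * (‖u‖ ^ α * K u)) hfm
    hK.continuous.measurable hK2.2 (hK2.1.const_mul _) fun u => ?_).trans (le_of_eq ?_)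
  · have h1 := hL (x + h • u) x
    rw [add_sub_cancel_left, norm_smul, Real.norm_eq_abs, abs_of_pos hh,
      Real.mul_rpow hh.le (norm_nonneg u)] at h1
    rw [abs_mul, abs_of_nonneg (hK.1 u)]
    have h2 := mul_le_mul_of_nonneg_left h1 (hK.1 u)
    linarith
  · rw [integral_const_mul]
    ring

theorem HolderControlAt.bias_le {α M : ℝ} (hα : 0 < α) {f c r K : 𝔼 → ℝ} {x : 𝔼}
    (hx : HolderControlAt α f c r x) (hfm : Measurable f) (hK : KernelK1 K) (hK3 : KernelK3 M K)
    (hK1 : ∫ u, K u = 1) {h : ℝ} (hh : 0 < h) (hr : h * M < r x) :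
    |(∫ u, K u * f (x + h • u)) - f x| ≤ c x * M ^ α * h ^ α := by
  refine (abs_integral_kernel_sub_le (G := fun u => c x * M ^ α * h ^ α * K u) hfm
    hK.continuous.measurable hK1 ((integrable_of_integral_eq_one hK1).const_mul _)
    fun u => ?_).trans (le_of_eq ?_)
  · by_cases hu : K u = 0
    · simp [hu]
    · have hM : ‖u‖ ≤ M := by simpa using hK3 hu
      have hn : ‖h • u‖ ≤ h * M := by
        rw [norm_smul, Real.norm_eq_abs, abs_of_pos hh]
        exact mul_le_mul_of_nonneg_left hM hh.le
      have h1 := hx.2 (h • u) (hn.trans_lt hr)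
      have h2 : ‖h • u‖ ^ α ≤ M ^ α * h ^ α := by
        rw [← Real.mul_rpow ((norm_nonneg u).trans hM) hh.le, mul_comm M h]
        exact Real.rpow_le_rpow (norm_nonneg _) hn hα.le
      have h3 := h1.trans (mul_le_mul_of_nonneg_left h2 hx.1)
      rw [abs_mul, abs_of_nonneg (hK.1 u)]
      have h4 := mul_le_mul_of_nonneg_left h3 (hK.1 u)
      linarith
  · rw [integral_const_mul, hK1, mul_one]

theorem IsDensityOf.integrable_and_integral_eq_one {Ω : Type*} [MeasurableSpace Ω]
    {μ : Measure Ω} [IsProbabilityMeasure μ] {Y : Ω → 𝔼} {f : 𝔼 → ℝ} (hf : IsDensityOf μ Y f)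
    (hY : Measurable Y) : Integrable f ∧ ∫ x, f x = 1 := by
  have h1 : ∫⁻ x, ENNReal.ofReal (f x) = 1 := by
    have := (Measure.isProbabilityMeasure_map (μ := μ) hY.aemeasurable).measure_univ
    rw [hf.2.2, withDensity_apply _ MeasurableSet.univ, Measure.restrict_univ] at this
    exact this
  refine ⟨⟨hf.1.aestronglyMeasurable,
    (hasFiniteIntegral_iff_ofReal (ae_of_all _ hf.2.1)).2 (by rw [h1]; exact ENNReal.one_lt_top)⟩, ?_⟩
  rw [integral_eq_lintegral_of_nonneg_ae (ae_of_all _ hf.2.1) hf.1.aestronglyMeasurable, h1,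
    ENNReal.toReal_one]

/-- On any unit ball a density takes a value not exceeding its average, which is at most the inverse
volume of the ball; Hölder continuity carries this bound to the centre. -/
theorem IsHolder.bounded {Ω : Type*} [MeasurableSpace Ω] {μ : Measure Ω} [IsProbabilityMeasure μ]
    {Y : Ω → 𝔼} {f : 𝔼 → ℝ} {α : ℝ} (hα : 0 < α) (hf : IsDensityOf μ Y f) (hY : Measurable Y)
    (hfH : IsHolder α f) : ∃ F : ℝ, ∀ x, f x ≤ F := by
  obtain ⟨L, hL⟩ := hfH
  obtain ⟨hi, h1⟩ := hf.integrable_and_integral_eq_one hY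
  refine ⟨(volume.real (Metric.ball (0 : 𝔼) 1))⁻¹ + |L|, fun x => ?_⟩
  have hpos : volume (Metric.ball x 1) ≠ 0 := (Metric.measure_ball_pos volume x one_pos).ne'
  obtain ⟨y, hy, hfy⟩ := exists_le_setAverage hpos measure_ball_lt_top.ne hi.integrableOn
  have h2 : f y ≤ (volume.real (Metric.ball (0 : 𝔼) 1))⁻¹ := by
    refine hfy.trans ?_
    rw [setAverage_eq, smul_eq_mul, Measure.addHaar_real_ball_center]
    refine mul_le_of_le_one_right (by positivity) ?_
    rw [← h1]
    exact setIntegral_le_integral hi (ae_of_all _ hf.2.1)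
  have h3 : ‖x - y‖ ^ α ≤ 1 := by
    refine Real.rpow_le_one (norm_nonneg _) ?_ hα.le
    rw [← dist_eq_norm, dist_comm]
    exact (Metric.mem_ball.1 hy).le
  have h4 : L * ‖x - y‖ ^ α ≤ |L| := by
    calc L * ‖x - y‖ ^ α ≤ |L| * ‖x - y‖ ^ α :=
          mul_le_mul_of_nonneg_right (le_abs_self L) (by positivity)
      _ ≤ |L| := mul_le_of_le_one_right (abs_nonneg L) h3
  have h5 := (le_abs_self _).trans (hL x y)
  linarith

/-- The kernel decays at least like `‖u‖ ^ (-β)`. -/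
def KernelDecay (β : ℝ) (K : 𝔼 → ℝ) : Prop := ∃ c : ℝ, ∀ u, K u * ‖u‖ ^ β ≤ c

theorem KernelK3.kernelDecay {M : ℝ} {K : 𝔼 → ℝ} (hK : KernelK1 K) (hK3 : KernelK3 M K) :
    KernelDecay 1 K := by
  obtain ⟨B, hB⟩ := hK.2.1
  refine ⟨B * |M|, fun u => ?_⟩
  have hB0 : 0 ≤ B := (hK.1 0).trans (hB 0)
  rw [Real.rpow_one]
  by_cases hu : K u = 0
  · rw [hu, zero_mul]
    positivity
  · have hM : ‖u‖ ≤ M := by simpa using hK3 hu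
    exact mul_le_mul (hB u) (hM.trans (le_abs_self M)) (norm_nonneg u) hB0

theorem KernelK2.mul_volume_ball_le {α : ℝ} (hα : 0 < α) {K : 𝔼 → ℝ} (hK0 : ∀ u, 0 ≤ K u)
    (hK2 : KernelK2 α K) {u : 𝔼} {r k : ℝ} (hr : 0 < r) (hru : 2 * r ≤ ‖u‖) (hk0 : 0 ≤ k)
    (hk : ∀ y, dist u y < r → k ≤ K y) :
    (‖u‖ / 2) ^ α * k * (r ^ D * volume.real (Metric.ball (0 : 𝔼) 1)) ≤
      ∫ u, ‖u‖ ^ α * K u := by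
  have hge : ∀ y ∈ Metric.ball u r, (‖u‖ / 2) ^ α * k ≤ ‖y‖ ^ α * K y := by
    intro y hy
    rw [Metric.mem_ball, dist_comm] at hy
    have h1 : ‖u‖ / 2 ≤ ‖y‖ := by
      have := norm_sub_norm_le u y
      rw [dist_eq_norm] at hy
      linarith
    exact mul_le_mul (Real.rpow_le_rpow (by positivity) h1 hα.le) (hk y hy) hk0
      (by positivity)
  have h1 := setIntegral_ge_of_const_le_real (μ := volume) measurableSet_ball
    measure_ball_lt_top.ne hge hK2.1.integrableOn
  rw [measureReal_def, Measure.addHaar_ball_of_pos _ _ hr, finrank_euclideanSpace_fin,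
    ENNReal.toReal_mul, ENNReal.toReal_ofReal (by positivity), ← measureReal_def] at h1
  exact h1.trans (setIntegral_le_integral hK2.1
    (ae_of_all _ fun y => mul_nonneg (by positivity) (hK0 y)))

/-- A Lipschitz function with value `k` at `u` stays above `k / 2` on a ball of radius proportional
to `k`. The moment integral over that ball is at least of order `‖u‖ ^ α * k ^ (D + 1)`, and taking
the root of order `D + 1` gives the exponent. -/
theorem KernelK2.kernelDecay {α : ℝ} (hα : 0 < α) {K : 𝔼 → ℝ} (hK : KernelK1 K)
    (hK2 : KernelK2 α K) : KernelDecay (α / (D + 1)) K := by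
  obtain ⟨hK0, ⟨B, hB⟩, ⟨l, hl⟩⟩ := hK
  have hB0 : 0 ≤ B := (hK0 0).trans (hB 0)
  have hl0 : (0 : ℝ) ≤ l := l.2
  obtain ⟨β, hβ⟩ : ∃ β : ℝ, β = α / (D + 1) := ⟨_, rfl⟩
  have hβ0 : 0 < β := by rw [hβ]; positivity
  have hball := fun u r k => hK2.mul_volume_ball_le hα hK0 (u := u) (r := r) (k := k)
  have hI0 : 0 ≤ ∫ u, ‖u‖ ^ α * K u :=
    integral_nonneg fun u => mul_nonneg (by positivity) (hK0 u)
  have hVpos : 0 < volume.real (Metric.ball (0 : 𝔼) 1) :=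
    ENNReal.toReal_pos (Metric.measure_ball_pos volume _ one_pos).ne' measure_ball_lt_top.ne
  rw [← hβ]
  generalize volume.real (Metric.ball (0 : 𝔼) 1) = V at hball hVpos
  generalize ∫ u, ‖u‖ ^ α * K u = I at hball hI0
  -- On the ball of radius `k / l'` the kernel loses at most `k / 2`. Adding `1` to the Lipschitz
  -- constant keeps `l'` positive and the radius at most `B / 2`, so for `‖u‖ > B + 1` the ball
  -- stays away from the origin.
  obtain ⟨l', hl'⟩ : ∃ l' : ℝ, l' = 2 * (l + 1) := ⟨_, rfl⟩
  have hl'pos : 0 < l' := by rw [hl']; positivity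
  obtain ⟨c, hc⟩ : ∃ c : ℝ, c = I * (2 ^ α * 2 * l' ^ D / V) := ⟨_, rfl⟩
  have hc0 : 0 ≤ c := by rw [hc]; positivity
  refine ⟨max (B * (B + 1) ^ β) (c + 1), fun u => ?_⟩
  by_cases hu : ‖u‖ ≤ B + 1
  · exact le_max_of_le_left (mul_le_mul (hB u) (Real.rpow_le_rpow (norm_nonneg u) hu hβ0.le)
      (by positivity) hB0)
  push Not at hu
  refine le_max_of_le_right ?_
  have hkB := hB u
  rcases (hK0 u).eq_or_lt with h0 | hpos
  · rw [← h0, zero_mul]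
    linarith
  have hlip : ∀ y, K u - K y ≤ l * dist u y := fun y =>
    (le_abs_self _).trans (hl.dist_le_mul u y)
  generalize K u = k at hlip hpos hkB
  have hr : 0 < k / l' := by positivity
  have hrB : 2 * (k / l') ≤ B := by
    rw [← mul_div_assoc, div_le_iff₀ hl'pos, hl']
    nlinarith
  have hint := hball u (k / l') (k / 2) hr (by linarith) (by linarith) fun y hy => by
    have h3 := hlip y
    have h5 : (l : ℝ) * dist u y ≤ (l + 1) * (k / l') :=
      mul_le_mul (by linarith) hy.le dist_nonneg (by positivity)
    have h6 : ((l : ℝ) + 1) * (k / l') = k / 2 := by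
      rw [hl']; field_simp
    linarith
  have hpow : (k * ‖u‖ ^ β) ^ (D + 1) ≤ c := by
    have h1 : (‖u‖ ^ β) ^ (D + 1) = ‖u‖ ^ α := by
      rw [← Real.rpow_natCast, ← Real.rpow_mul (norm_nonneg u), hβ]
      congr 1
      push_cast
      field_simp
    rw [mul_pow, h1, hc]
    have h2 : k ^ (D + 1) * ‖u‖ ^ α =
        (‖u‖ / 2) ^ α * (k / 2) * ((k / l') ^ D * V) * (2 ^ α * 2 * l' ^ D / V) := by
      rw [Real.div_rpow (norm_nonneg u) two_pos.le, div_pow]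
      have : (2 : ℝ) ^ α ≠ 0 := by positivity
      field_simp
      ring
    rw [h2]
    exact mul_le_mul_of_nonneg_right hint (by positivity)
  -- The root is avoided: a number above `c + 1 ≥ 1` is at most its power of order `D + 1`, which is
  -- at most `c`.
  by_contra! hcon
  have h1 : 1 ≤ k * ‖u‖ ^ β := by linarith
  have h2 := le_self_pow₀ h1 (show D + 1 ≠ 0 by omega)
  linarith

end KernelFacts

/-! ### Orders of magnitude of bandwidths and block lengths -/

section Asymptotics

/-- Polynomial bounds for a bandwidth `h` of the order `((log n)^p / n)^(1/(2α+D))`. -/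
structure BandwidthBounds (D : ℕ) (α p h : ℝ) (n : ℕ) : Prop where
  one_le_log : 1 ≤ Real.log n
  pos : 0 < h
  le_one : h ≤ 1
  ge : (n : ℝ) ^ (-(1 / (2 * α + D))) ≤ h
  le : h ≤ (n : ℝ) ^ (-(3 / 4 * (1 / (2 * α + D))))
  mul_eq : (n : ℝ) * (h ^ D * (h ^ α) ^ 2) = Real.log n ^ p

theorem eventually_log_rpow_le (p : ℝ) {c : ℝ} (hc : 0 < c) :
    ∀ᶠ n : ℕ in atTop, 1 ≤ Real.log n ∧ Real.log n ^ p ≤ (n : ℝ) ^ c := by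
  have h1 : ∀ᶠ n : ℕ in atTop, 1 ≤ Real.log n :=
    (Real.tendsto_log_atTop.comp tendsto_natCast_atTop_atTop).eventually_ge_atTop 1
  have h2 := ((isLittleO_log_rpow_rpow_atTop p hc).comp_tendsto
    tendsto_natCast_atTop_atTop).bound one_pos
  filter_upwards [h1, h2] with n hn1 hn2
  refine ⟨hn1, ?_⟩
  simp only [Function.comp_apply, Real.norm_eq_abs, one_mul] at hn2
  rw [abs_of_nonneg (by positivity : (0 : ℝ) ≤ (n : ℝ) ^ c)] at hn2
  exact (le_abs_self _).trans hn2

theorem rate_eq_bandwidth_rpow (D : ℕ) (α p : ℝ) {n : ℕ} (hn : 0 ≤ logRatio p n) :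
    rate D α p n = bandwidth D α p n ^ α := by
  rw [rate, bandwidth, ← Real.rpow_mul hn, one_div_mul_eq_div]

/-- The logarithmic power lies between `1` and `n ^ (1 / 4)`, which pins the bandwidth between two
powers of `n`; the loss from `1` to `3 / 4` in the exponent leaves room for the comparison of
scales. -/
theorem eventually_bandwidthBounds {D : ℕ} (hD : 0 < D) {α p : ℝ} (hα : 0 < α) (hp : 1 ≤ p) :
    ∀ᶠ n : ℕ in atTop, BandwidthBounds D α p (bandwidth D α p n) n ∧
      rate D α p n = bandwidth D α p n ^ α := by
  have hD' : (1 : ℝ) ≤ D := by exact_mod_cast hD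
  filter_upwards [eventually_log_rpow_le p (show (0 : ℝ) < 1 / 4 by norm_num),
    eventually_gt_atTop 0] with n ⟨h1, h2⟩ hn
  have hn1 : (1 : ℝ) ≤ n := by exact_mod_cast hn
  have hn0 : (0 : ℝ) < n := by linarith
  have hlp : 1 ≤ Real.log n ^ p := Real.one_le_rpow h1 (by linarith)
  obtain ⟨θ, hθ⟩ : ∃ θ : ℝ, θ = 1 / (2 * α + D) := ⟨_, rfl⟩
  have hθ0 : 0 < θ := by rw [hθ]; positivity
  have hr0 : 0 < logRatio p n := by rw [logRatio]; positivity
  have hge : (n : ℝ) ^ (-1 : ℝ) ≤ logRatio p n := by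
    rw [Real.rpow_neg_one, logRatio, inv_eq_one_div]
    gcongr
  have hle : logRatio p n ≤ (n : ℝ) ^ (-(3 / 4) : ℝ) := by
    rw [logRatio, div_le_iff₀ hn0]
    calc Real.log n ^ p ≤ (n : ℝ) ^ (1 / 4 : ℝ) := h2
      _ = (n : ℝ) ^ (-(3 / 4) : ℝ) * n := by
        rw [← Real.rpow_add_one hn0.ne']; norm_num
  have hb : bandwidth D α p n = logRatio p n ^ θ := by rw [bandwidth, hθ]
  have hpos : 0 < bandwidth D α p n := by rw [hb]; positivity
  have hle' : bandwidth D α p n ≤ (n : ℝ) ^ (-(3 / 4 * θ)) := by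
    rw [hb]
    refine (Real.rpow_le_rpow hr0.le hle hθ0.le).trans_eq ?_
    rw [← Real.rpow_mul hn0.le]
    congr 1
    ring
  refine ⟨⟨h1, hpos, ?_, ?_, ?_, ?_⟩, rate_eq_bandwidth_rpow D α p hr0.le⟩
  · exact hle'.trans (Real.rpow_le_one_of_one_le_of_nonpos hn1 (by nlinarith))
  · rw [← hθ, hb]
    refine le_of_eq_of_le ?_ (Real.rpow_le_rpow (by positivity) hge hθ0.le)
    rw [← Real.rpow_mul hn0.le]
    congr 1
    ring
  · rwa [← hθ]
  · have h3 : bandwidth D α p n ^ D * (bandwidth D α p n ^ α) ^ 2 = logRatio p n := by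
      rw [← Real.rpow_natCast, ← Real.rpow_natCast, ← Real.rpow_mul hpos.le,
        ← Real.rpow_add hpos, hb, ← Real.rpow_mul hr0.le]
      have : θ * ((D : ℝ) + α * (2 : ℕ)) = 1 := by
        rw [hθ]; push_cast; field_simp; ring
      rw [this, Real.rpow_one]
    rw [h3, logRatio]
    field_simp

theorem summable_exp_neg_mul_rpow {c γ : ℝ} (hc : 0 < c) (hγ : 0 < γ) :
    Summable fun k : ℕ => Real.exp (-c * (k : ℝ) ^ γ) := by
  have ht : Tendsto (fun k : ℕ => (k : ℝ) ^ γ) atTop atTop :=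
    (tendsto_rpow_atTop hγ).comp tendsto_natCast_atTop_atTop
  have h1 := ((isLittleO_exp_neg_mul_rpow_atTop hc (-2 / γ)).comp_tendsto ht).isBigO
  refine summable_of_isBigO_nat (g := fun k : ℕ => (k : ℝ) ^ (-2 : ℝ))
    (Real.summable_nat_rpow.2 (by norm_num)) (h1.congr_right fun k => ?_)
  simp only [Function.comp_apply]
  rw [← Real.rpow_mul (Nat.cast_nonneg k)]
  congr 1
  field_simp

/-- Block lengths of logarithmic order, long enough to kill a polynomial factor. -/
theorem exists_block_length {b γ κ : ℝ} (hb : 0 < b) (hγ : 0 < γ) (hκ : 0 < κ) (B : ℝ) :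
    ∃ ℓ : ℕ → ℕ, (∀ n, 1 ≤ ℓ n) ∧
      (∀ c : ℝ, 0 < c → Tendsto (fun n : ℕ => (ℓ n : ℝ) * (n : ℝ) ^ (-c)) atTop (𝓝 0)) ∧
      ∀ᶠ n : ℕ in atTop, Real.exp (-b * (ℓ n : ℝ) ^ γ) * (B + (n : ℝ) ^ κ) ≤ 1 / n := by
  -- This length makes the mixing factor at most `n ^ (-(κ + 2))`: one factor `n ^ κ` is for the
  -- semi-norm, one factor `n` absorbs `B`, and one is left for the bound `1 / n`.
  refine ⟨fun n => ⌈((κ + 2) / b * Real.log n) ^ (1 / γ)⌉₊ + 1, fun n => Nat.le_add_left 1 _, ?_, ?_⟩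
  · intro c hc
    set A : ℝ := ((κ + 2) / b) ^ (1 / γ) with hA
    have h1 : Tendsto (fun n : ℕ => Real.log n ^ (1 / γ) / (n : ℝ) ^ c) atTop (𝓝 0) :=
      ((isLittleO_log_rpow_rpow_atTop (1 / γ) hc).comp_tendsto
        tendsto_natCast_atTop_atTop).tendsto_div_nhds_zero
    have h2 : Tendsto (fun n : ℕ => (n : ℝ) ^ (-c)) atTop (𝓝 0) :=
      (tendsto_rpow_neg_atTop hc).comp tendsto_natCast_atTop_atTop
    have h3 := (h1.const_mul A).add (h2.const_mul 2)
    rw [mul_zero, mul_zero, add_zero] at h3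
    refine squeeze_zero' (Eventually.of_forall fun n => by positivity) ?_ h3
    filter_upwards [eventually_gt_atTop 0] with n hn
    have hlog : 0 ≤ Real.log n := Real.log_natCast_nonneg n
    have h4 := (Nat.ceil_lt_add_one (a := ((κ + 2) / b * Real.log n) ^ (1 / γ)) (by positivity)).le
    rw [Real.mul_rpow (by positivity) hlog, ← hA] at h4
    have h5 : 0 ≤ (n : ℝ) ^ (-c) := by positivity
    have h6 := mul_le_mul_of_nonneg_right h4 h5
    have h7 : Real.log n ^ (1 / γ) / (n : ℝ) ^ c = Real.log n ^ (1 / γ) * (n : ℝ) ^ (-c) := by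
      rw [Real.rpow_neg (Nat.cast_nonneg n), div_eq_mul_inv]
    rw [h7]
    push_cast
    rw [Real.mul_rpow (by positivity) hlog, ← hA]
    linarith
  · filter_upwards [eventually_gt_atTop 0, eventually_ge_atTop ⌈|B| + 1⌉₊] with n hn hnB
    have hn1 : (1 : ℝ) ≤ n := by exact_mod_cast hn
    have hn0 : (0 : ℝ) < n := by linarith
    have hnB' : |B| + 1 ≤ n := Nat.ceil_le.1 hnB
    have hlog : 0 ≤ Real.log n := Real.log_natCast_nonneg n
    have h1 : (κ + 2) / b * Real.log n ≤
        ((⌈((κ + 2) / b * Real.log n) ^ (1 / γ)⌉₊ + 1 : ℕ) : ℝ) ^ γ := by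
      have h2 : ((κ + 2) / b * Real.log n) ^ (1 / γ) ≤
          ((⌈((κ + 2) / b * Real.log n) ^ (1 / γ)⌉₊ + 1 : ℕ) : ℝ) := by
        push_cast
        linarith [Nat.le_ceil (((κ + 2) / b * Real.log n) ^ (1 / γ))]
      have h3 := Real.rpow_le_rpow (by positivity) h2 hγ.le
      rwa [← Real.rpow_mul (by positivity), one_div_mul_cancel hγ.ne', Real.rpow_one] at h3
    have h4 : Real.exp (-b * ((⌈((κ + 2) / b * Real.log n) ^ (1 / γ)⌉₊ + 1 : ℕ) : ℝ) ^ γ) ≤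
        (n : ℝ) ^ (-(κ + 2)) := by
      rw [Real.rpow_def_of_pos hn0]
      refine Real.exp_le_exp.2 ?_
      have h5 := mul_le_mul_of_nonneg_left h1 hb.le
      have h6 : b * ((κ + 2) / b * Real.log n) = (κ + 2) * Real.log n := by field_simp
      linarith
    have h7 : B + (n : ℝ) ^ κ ≤ n * (n : ℝ) ^ κ := by
      have h8 : 1 ≤ (n : ℝ) ^ κ := Real.one_le_rpow hn1 hκ.le
      have h9 := le_abs_self B
      have h10 := abs_nonneg B
      nlinarith
    calc Real.exp (-b * ((⌈((κ + 2) / b * Real.log n) ^ (1 / γ)⌉₊ + 1 : ℕ) : ℝ) ^ γ) *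
          (B + (n : ℝ) ^ κ) ≤ Real.exp (-b * ((⌈((κ + 2) / b * Real.log n) ^ (1 / γ)⌉₊ + 1 : ℕ) : ℝ)
            ^ γ) * (n * (n : ℝ) ^ κ) := by gcongr
      _ ≤ (n : ℝ) ^ (-(κ + 2)) * (n * (n : ℝ) ^ κ) := by gcongr
      _ = 1 / n := by
        rw [neg_add, Real.rpow_add hn0, Real.rpow_neg hn0.le,
          show (-2 : ℝ) = -(2 : ℕ) by norm_num, Real.rpow_neg hn0.le, Real.rpow_natCast]
        field_simp

end Asymptotics

/-! ### Short lags: comparison with a coarser bandwidth -/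

section Domination

variable {D : ℕ}

local notation "𝔼" => EuclideanSpace ℝ (Fin D)

/-- A rescaled kernel is dominated by a translate at a coarser scale, up to a small constant. -/
theorem kernel_le_coarser {K : 𝔼 → ℝ} (hK0 : ∀ u, 0 ≤ K u) {B : ℝ} (hB : ∀ u, K u ≤ B) {u₀ : 𝔼}
    {ρ η : ℝ} (hρ : 0 < ρ) (hη : 0 < η) (hball : ∀ u, ‖u - u₀‖ ≤ ρ → η ≤ K u) {β c : ℝ}
    (hβ : 0 < β) (hdecay : ∀ u, K u * ‖u‖ ^ β ≤ c) {h h' : ℝ} (hh : 0 < h) (hh' : 0 < h')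
    (x z : 𝔼) :
    K (h⁻¹ • (z - x)) ≤
      B / η * K (h'⁻¹ • (z - (x - h' • u₀))) + c / (ρ * (h' / h)) ^ β := by
  have hB0 : 0 ≤ B := (hK0 0).trans (hB 0)
  have hc0 : 0 ≤ c := (mul_nonneg (hK0 0) (by positivity)).trans (hdecay 0)
  -- Near `x` the coarse kernel, recentred so that `x` corresponds to `u₀`, is at least `η` and
  -- dominates after scaling by `B / η`. Away from `x` the fine kernel is already in its tail.
  by_cases hw : ‖z - x‖ ≤ ρ * h'
  · have h1 : h'⁻¹ • (z - (x - h' • u₀)) - u₀ = h'⁻¹ • (z - x) := by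
      rw [sub_sub_eq_add_sub, add_sub_right_comm, smul_add, inv_smul_smul₀ hh'.ne',
        add_sub_cancel_right]
    have h2 : η ≤ K (h'⁻¹ • (z - (x - h' • u₀))) := by
      refine hball _ ?_
      rw [h1, norm_smul, Real.norm_eq_abs, abs_of_pos (by positivity), inv_mul_le_iff₀ hh']
      linarith
    have h3 : B ≤ B / η * K (h'⁻¹ • (z - (x - h' • u₀))) := by
      calc B = B / η * η := by field_simp
        _ ≤ _ := by gcongr
    have h4 : 0 ≤ c / (ρ * (h' / h)) ^ β := by positivity
    linarith [hB (h⁻¹ • (z - x))]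
  · push Not at hw
    have h1 : ρ * (h' / h) ≤ ‖h⁻¹ • (z - x)‖ := by
      rw [norm_smul, Real.norm_eq_abs, abs_of_pos (by positivity), ← mul_div_assoc, div_eq_inv_mul]
      gcongr
    have h2 : K (h⁻¹ • (z - x)) ≤ c / (ρ * (h' / h)) ^ β := by
      rw [le_div_iff₀ (by positivity)]
      refine le_trans ?_ (hdecay (h⁻¹ • (z - x)))
      have := hK0 (h⁻¹ • (z - x))
      gcongr
    have h3 : 0 ≤ B / η * K (h'⁻¹ • (z - (x - h' • u₀))) :=
      mul_nonneg (by positivity) (hK0 _)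
    linarith

theorem CSpace.cNorm_le {Z : Type*} [MeasurableSpace Z] [Nonempty Z] (C : CSpace Z)
    {g : C.carrier} {B A : ℝ} (hg : ∀ z, |g.1 z| ≤ B) (hA : C.semi g ≤ A) :
    C.cNorm g ≤ B + A :=
  add_le_add (ciSup_le hg) hA

theorem rpow_neg_le_two_mul {x y s : ℝ} (hy : 0 < y) (hs0 : 0 ≤ s) (hs1 : s ≤ 1)
    (h : y ≤ 2 * x) : x ^ (-s) ≤ 2 * y ^ (-s) := by
  have h1 : x ^ (-s) ≤ (y / 2) ^ (-s) :=
    Real.rpow_le_rpow_of_nonpos (by positivity) (by linarith) (by linarith)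
  have h2 : (2 : ℝ) ^ s ≤ 2 := by
    simpa using Real.rpow_le_rpow_of_exponent_le (one_le_two : (1 : ℝ) ≤ 2) hs1
  rw [Real.div_rpow hy.le two_pos.le, Real.rpow_neg two_pos.le, div_inv_eq_mul, mul_comm] at h1
  exact h1.trans (mul_le_mul_of_nonneg_right h2 (by positivity))

/-- The integer is the minimum of the floors of `t` and `√N`. The floors cost at most a factor `2`,
and the last clause records which of the two is attained. -/
theorem exists_nat_between_sqrt {t : ℝ} {m N : ℕ} (hm : 0 < m) (ht : (m : ℝ) ≤ t)
    (hN : m * m ≤ N) :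
    ∃ n : ℕ, m ≤ n ∧ (n : ℝ) ≤ t ∧ (n : ℝ) ≤ (N : ℝ) ^ (1 / 2 : ℝ) ∧
      (t ≤ 2 * n ∨ (N : ℝ) ^ (1 / 2 : ℝ) ≤ 2 * n) := by
  have h1 : m ≤ ⌊t⌋₊ := Nat.le_floor ht
  have h2 : m ≤ N.sqrt := Nat.le_sqrt.2 hN
  have ht0 : 0 ≤ t := (Nat.cast_nonneg m).trans ht
  have h3 : t ≤ 2 * ⌊t⌋₊ := by
    have := (Nat.lt_floor_add_one t).le
    have : (1 : ℝ) ≤ ⌊t⌋₊ := by exact_mod_cast hm.trans_le h1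
    linarith
  have h4 : (N.sqrt : ℝ) ≤ (N : ℝ) ^ (1 / 2 : ℝ) := by
    rw [← Real.sqrt_eq_rpow]
    exact Real.nat_sqrt_le_real_sqrt
  have h5 : (N : ℝ) ^ (1 / 2 : ℝ) ≤ 2 * N.sqrt := by
    rw [← Real.sqrt_eq_rpow]
    have := Real.real_sqrt_le_nat_sqrt_succ (a := N)
    have : (1 : ℝ) ≤ N.sqrt := by exact_mod_cast hm.trans_le h2
    linarith
  rcases le_total ⌊t⌋₊ N.sqrt with h | h
  · exact ⟨⌊t⌋₊, h1, Nat.floor_le ht0, (Nat.cast_le.2 h).trans h4, Or.inl h3⟩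
  · exact ⟨N.sqrt, h2, (Nat.cast_le.2 h).trans (Nat.floor_le ht0), h4, Or.inr h5⟩

/-- Here `T` stands for `k ^ γ`, and the left side bounds the coarse bandwidth, hence the mean of
the coarse kernel. It is exponentially small in `T` when `n` follows the exponential, and
polynomially small in `N` when `n` follows `√N`. -/
theorem coarse_rpow_le {N n b κ T θ c : ℝ} (hN1 : 1 ≤ N) (hT0 : 0 ≤ T) (hθ0 : 0 < θ)
    (hθ1 : θ ≤ 1) (hc2 : c ≤ 3 / 4 * θ * (b / (2 * κ))) (hc3 : c ≤ 3 / 8 * θ)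
    (hor : Real.exp (b * T / (2 * κ)) ≤ 2 * n ∨ N ^ (1 / 2 : ℝ) ≤ 2 * n) :
    n ^ (-(3 / 4 * θ)) ≤ 2 * (Real.exp (-c * T) + N ^ (-c)) := by
  have hN0 : 0 < N := by linarith
  have hE0 := Real.exp_pos (-c * T)
  have hP0 : 0 < N ^ (-c) := by positivity
  rcases hor with h1 | h1
  · refine (rpow_neg_le_two_mul (Real.exp_pos _) (by positivity) (by linarith) h1).trans ?_
    rw [← Real.exp_mul]
    have h2 : Real.exp (b * T / (2 * κ) * -(3 / 4 * θ)) ≤ Real.exp (-c * T) := by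
      refine Real.exp_le_exp.2 ?_
      have h3 := mul_le_mul_of_nonneg_right hc2 hT0
      have h4 : b * T / (2 * κ) * -(3 / 4 * θ) = -(3 / 4 * θ * (b / (2 * κ)) * T) := by ring
      linarith
    linarith
  · refine (rpow_neg_le_two_mul (by positivity) (by positivity) (by linarith) h1).trans ?_
    rw [← Real.rpow_mul hN0.le]
    have h2 : N ^ (1 / 2 * -(3 / 4 * θ)) ≤ N ^ (-c) :=
      Real.rpow_le_rpow_of_exponent_le hN1 (by linarith)
    linarith

/-- The cap on `n` makes `n ^ κ` at most `exp (b * T / 2)`, so half of the mixing exponent survives.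
-/
theorem exp_mul_coarse_le {n b κ T B c : ℝ} (hκ : 0 < κ) (hT0 : 0 ≤ T) (hB0 : 0 ≤ B)
    (hc1 : c ≤ b / 2) (hb : 0 ≤ b) (hn0 : 0 ≤ n) (hnt : n ≤ Real.exp (b * T / (2 * κ))) :
    Real.exp (-b * T) * (B + n ^ κ) ≤ (B + 1) * Real.exp (-c * T) := by
  have h1 : Real.exp (-b * T) ≤ Real.exp (-c * T) := Real.exp_le_exp.2 (by nlinarith)
  have h2 : Real.exp (-b * T) * n ^ κ ≤ Real.exp (-c * T) := by
    calc Real.exp (-b * T) * n ^ κ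
        ≤ Real.exp (-b * T) * (Real.exp (b * T / (2 * κ))) ^ κ := by gcongr
      _ = Real.exp (-(b / 2 * T)) := by
        rw [← Real.exp_mul, ← Real.exp_add]
        congr 1
        field_simp
        ring
      _ ≤ Real.exp (-c * T) := Real.exp_le_exp.2 (by nlinarith)
  have h3 := mul_le_mul_of_nonneg_left h1 hB0
  linarith

/-- The rescaled kernels have small conditional means already at short lags: for a lag `k` one uses
the kernel at an earlier and coarser bandwidth, whose semi-norm is still controlled. -/
theorem KernelK4.exists_dominating (hD : 0 < D) {S : Set 𝔼} [Nonempty S] {C : CSpace S}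
    {K : 𝔼 → ℝ} (hK : KernelK1 K) (hK1 : ∫ u, K u = 1) {β : ℝ} (hβ : 0 < β)
    (hdecay : KernelDecay β K) {α p : ℝ} (hα : 0 < α) (hp : 1 ≤ p)
    (hK4 : KernelK4 C K (bandwidth D α p)) {ν : Measure S} {F : ℝ} (hF0 : 0 ≤ F)
    (hF : ∀ (h : ℝ) (x : 𝔼), 0 < h → ∫ z : S, K (h⁻¹ • ((z : 𝔼) - x)) ∂ν ≤ F * h ^ D)
    {b γ : ℝ} (hb : 0 < b) :
    ∃ A c : ℝ, 0 < A ∧ 0 < c ∧ ∀ᶠ N : ℕ in atTop, ∀ (x : 𝔼) (k : ℕ),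
      ∃ (a e : ℝ) (g : C.carrier), 0 ≤ a ∧ 0 ≤ e ∧
        (∀ z : S, K ((bandwidth D α p N)⁻¹ • ((z : 𝔼) - x)) ≤ a * g.1 z + e) ∧
        a * ((∫ z, g.1 z ∂ν) + Real.exp (-b * (k : ℝ) ^ γ) * C.cNorm g) + e ≤
          A * (Real.exp (-c * (k : ℝ) ^ γ) + (N : ℝ) ^ (-c)) := by
  obtain ⟨κ, hκ, hK4⟩ := hK4
  obtain ⟨u₀, ρ, η, hρ, hη, hball⟩ := hK.exists_ball_le hK1
  obtain ⟨hK0, ⟨B, hB⟩, -⟩ := hK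
  obtain ⟨d, hd⟩ := hdecay
  have hB0 : 0 ≤ B := (hK0 0).trans (hB 0)
  have hd0 : 0 ≤ d := (mul_nonneg (hK0 0) (by positivity)).trans (hd 0)
  obtain ⟨n₀, hn₀⟩ := eventually_atTop.1 (hK4.and (eventually_bandwidthBounds hD hα hp))
  obtain ⟨θ, hθ⟩ : ∃ θ : ℝ, θ = 1 / (2 * α + D) := ⟨_, rfl⟩
  have hθ0 : 0 < θ := by rw [hθ]; positivity
  have hθ1 : θ ≤ 1 := by
    have hD' : (1 : ℝ) ≤ D := by exact_mod_cast hD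
    rw [hθ, div_le_one (by positivity)]
    linarith
  -- The first bound on `c` serves the mixing remainder, the next two the mean of the coarse kernel
  -- in the two regimes of `n`, and the last the tail of the fine kernel.
  obtain ⟨c, hc0, hc1, hc2, hc3, hc4⟩ : ∃ c : ℝ, 0 < c ∧ c ≤ b / 2 ∧
      c ≤ 3 / 4 * θ * (b / (2 * κ)) ∧ c ≤ 3 / 8 * θ ∧ c ≤ θ * β / 4 :=
    ⟨min (min (b / 2) (3 / 4 * θ * (b / (2 * κ)))) (min (3 / 8 * θ) (θ * β / 4)), by positivity,
      (min_le_left _ _).trans (min_le_left _ _), (min_le_left _ _).trans (min_le_right _ _),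
      (min_le_right _ _).trans (min_le_left _ _), (min_le_right _ _).trans (min_le_right _ _)⟩
  obtain ⟨Λ, hΛ⟩ : ∃ Λ : ℝ, Λ = Real.exp (c * (2 * κ / b) * Real.log (n₀ + 3 : ℕ)) := ⟨_, rfl⟩
  have hΛ0 : 0 < Λ := by rw [hΛ]; positivity
  have hAle : 0 ≤ B / η * (2 * F + B + 1) + d / ρ ^ β := by positivity
  refine ⟨B / η * (2 * F + B + 1) + d / ρ ^ β + B * Λ + 1, c, by positivity, hc0, ?_⟩
  filter_upwards [eventually_ge_atTop ((n₀ + 3) * (n₀ + 3))] with N hN x k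
  have hNn₀ : n₀ ≤ N := by nlinarith
  have hN1 : (1 : ℝ) ≤ N := by exact_mod_cast (by nlinarith : 1 ≤ N)
  have hN0 : (0 : ℝ) < N := by linarith
  obtain ⟨T, hT⟩ : ∃ T : ℝ, T = (k : ℝ) ^ γ := ⟨_, rfl⟩
  have hT0 : 0 ≤ T := by rw [hT]; positivity
  rw [← hT]
  obtain ⟨E, hE⟩ : ∃ E : ℝ, E = Real.exp (-c * T) := ⟨_, rfl⟩
  obtain ⟨P, hP⟩ : ∃ P : ℝ, P = (N : ℝ) ^ (-c) := ⟨_, rfl⟩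
  have hE0 : 0 < E := by rw [hE]; positivity
  have hP0 : 0 < P := by rw [hP]; positivity
  rw [← hE, ← hP]
  obtain ⟨-, hbN, -⟩ := hn₀ N hNn₀
  rcases lt_or_ge (Real.exp (b * T / (2 * κ))) (n₀ + 3 : ℕ) with hlt | hge
  -- For these boundedly short lags no admissible `n` exists; the constant `B` dominates, and `Λ`
  -- absorbs the missing factor `exp (-c * T)`.
  · refine ⟨0, B, 0, le_rfl, hB0, fun z => by simpa using hB _, ?_⟩
    rw [zero_mul, zero_add]
    have h1 : 1 ≤ Λ * E := by
      rw [hΛ, hE, ← Real.exp_add]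
      refine Real.one_le_exp ?_
      have h2 := (Real.lt_log_iff_exp_lt (by positivity)).2 hlt
      have h3 : b * T / (2 * κ) * (2 * κ / b) = T := by field_simp
      have h4 : T ≤ 2 * κ / b * Real.log (n₀ + 3 : ℕ) := by
        rw [← h3, mul_comm]
        gcongr
      have h5 := mul_le_mul_of_nonneg_left h4 hc0.le
      linarith
    have h2 : B ≤ B * Λ * E := by
      rw [mul_assoc]
      exact le_mul_of_one_le_right hB0 h1
    have h3 : 0 ≤ (B / η * (2 * F + B + 1) + d / ρ ^ β + 1) * (E + P) := by positivity
    have h4 : 0 ≤ B * Λ * P := by positivity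
    linarith
  · obtain ⟨n, hn, hnt, hnN, hor⟩ := exists_nat_between_sqrt (by omega) hge hN
    obtain ⟨hKn, hbn, -⟩ := hn₀ n (by omega)
    have hn0 : (0 : ℝ) < n := by exact_mod_cast (by omega : 0 < n)
    obtain ⟨hgC, hsemi⟩ := hKn (x - bandwidth D α p n • u₀)
    have hgeN := hbN.le
    have hgen := hbn.ge
    have hlen := hbn.le
    rw [← hθ] at hgeN hgen hlen
    have hdomz := fun z : S => kernel_le_coarser hK0 hB hρ hη hball hβ hd hbN.pos hbn.pos x z
    have hint := hF _ (x - bandwidth D α p n • u₀) hbn.pos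
    have hnorm := C.cNorm_le (g := ⟨_, hgC⟩) (B := B)
      (fun z => by rw [abs_of_nonneg (hK0 _)]; exact hB _) hsemi
    have hbD : bandwidth D α p n ^ D ≤ bandwidth D α p n :=
      pow_le_of_le_one hbn.pos.le hbn.le_one hD.ne'
    -- Since `n ≤ √N`, the coarse bandwidth is at least `N ^ (-θ / 2)`, against at most `N ^ (-3 * θ
    -- / 4)` for the fine one; this gap makes the tail term polynomially small.
    have hratio : (N : ℝ) ^ (θ / 4) ≤ bandwidth D α p n / bandwidth D α p N := by
      rw [le_div_iff₀ hbN.pos]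
      calc (N : ℝ) ^ (θ / 4) * bandwidth D α p N
          ≤ (N : ℝ) ^ (θ / 4) * (N : ℝ) ^ (-(3 / 4 * θ)) := by gcongr
        _ = ((N : ℝ) ^ (1 / 2 : ℝ)) ^ (-θ) := by
            rw [← Real.rpow_add hN0, ← Real.rpow_mul hN0.le]
            congr 1
            ring
        _ ≤ (n : ℝ) ^ (-θ) := Real.rpow_le_rpow_of_nonpos hn0 hnN (by linarith)
        _ ≤ _ := hgen
    have hpos := hbn.pos
    have hposN := hbN.pos
    generalize bandwidth D α p n = h' at *
    generalize bandwidth D α p N = h at *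
    have hR : 0 < ρ * (h' / h) := by positivity
    refine ⟨B / η, d / (ρ * (h' / h)) ^ β, ⟨_, hgC⟩, by positivity, by positivity, hdomz, ?_⟩
    have he : d / (ρ * (h' / h)) ^ β ≤ d / ρ ^ β * P := by
      have h1 : (N : ℝ) ^ c ≤ (h' / h) ^ β := by
        calc (N : ℝ) ^ c ≤ (N : ℝ) ^ (θ / 4 * β) :=
              Real.rpow_le_rpow_of_exponent_le hN1 (by linarith)
          _ = ((N : ℝ) ^ (θ / 4)) ^ β := by rw [Real.rpow_mul hN0.le]
          _ ≤ _ := Real.rpow_le_rpow (by positivity) hratio hβ.le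
      rw [Real.mul_rpow hρ.le (by positivity), ← div_div, hP, Real.rpow_neg hN0.le,
        ← div_eq_mul_inv]
      gcongr
    have hsmall := coarse_rpow_le hN1 hT0 hθ0 hθ1 hc2 hc3 hor
    have hexp := exp_mul_coarse_le hκ hT0 hB0 hc1 (by linarith) hn0.le hnt
    rw [← hE, ← hP] at hsmall
    rw [← hE] at hexp
    have h1 : (∫ z : S, K (h'⁻¹ • ((z : 𝔼) - (x - h' • u₀))) ∂ν) +
        Real.exp (-b * T) * C.cNorm ⟨_, hgC⟩ ≤ (2 * F + B + 1) * (E + P) := by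
      have h2 := mul_le_mul_of_nonneg_left hnorm (Real.exp_pos (-b * T)).le
      have h3 := mul_le_mul_of_nonneg_left ((hbD.trans hlen).trans hsmall) hF0
      have h4 : 0 ≤ (B + 1) * P := by positivity
      linarith
    have h2 := mul_le_mul_of_nonneg_left h1 (show 0 ≤ B / η by positivity)
    have h3 : 0 ≤ d / ρ ^ β * E + (B * Λ + 1) * (E + P) := by positivity
    simp only at h1 h2 ⊢
    linarith

end Domination

/-! ### Deviation inequality at one point -/

section Deviation

variable {D : ℕ}

local notation "𝔼" => EuclideanSpace ℝ (Fin D)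

/-- Up to the order of summation, a C-mixing process is decoupled from its past, whichever the
direction of time. -/
theorem exists_pastDecoupled {Ω : Type*} [MeasurableSpace Ω] {Z : Type*} [MeasurableSpace Z]
    {μ : Measure Ω} [IsProbabilityMeasure μ] {X : ℕ → Ω → Z} (hX : ∀ i, Measurable (X i))
    (hstat : IsStrictlyStationary μ X) {C : CSpace Z} {b γ : ℝ} (hb : 0 < b) (hγ : 0 < γ)
    (hmix : IsGeomCMixing μ X C b γ ∨ IsGeomTimeReversedCMixing μ X C b γ) (N : ℕ) :
    ∃ Y : ℕ → Ω → Z, (∀ i, Measurable (Y i)) ∧ (∀ i, μ.map (Y i) = μ.map (X 0)) ∧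
      PastDecoupled μ Y C b γ N ∧ ∀ (F : Z → ℝ) (ω : Ω),
        ∑ i ∈ Finset.range N, F (Y i ω) = ∑ i ∈ Finset.range N, F (X i ω) := by
  rcases hmix with h | h
  · exact ⟨X, hX, hstat.map_eq hX, h.pastDecoupled hX hb hγ N, fun _ _ => rfl⟩
  · exact ⟨fun i => X (N - 1 - i), fun i => hX _, fun i => hstat.map_eq hX _,
      h.pastDecoupled hX hb hγ N, fun F ω => Finset.sum_range_reflect (fun i => F (X i ω)) N⟩

/-- With `s = h ^ α` and `H = h ^ D` every term of the exponent is at most a constant times `ϖ = n *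
h ^ (D + 2 * α)`. The condition `ℓ * m ≤ 1` reduces the squared mean to the order of the variance.
-/
theorem bernstein_exponent_le {n s δ ℓ m H Q F ϖ : ℝ} (hn : 0 ≤ n) (hs0 : 0 ≤ s) (hs1 : s ≤ 1)
    (hδ0 : 0 ≤ δ) (hδ : n * δ ≤ 1) (hm0 : 0 ≤ m) (hm : m ≤ F * H) (hℓ : ℓ * m ≤ 1) (hQ : 0 ≤ Q)
    (hH : n * (H * s ^ 2) = ϖ) (hϖ : 1 ≤ ϖ) :
    2 * n * (s * δ + s ^ 2 * (ℓ * m ^ 2 + (m + δ) * (2 * Q))) ≤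
      (2 + 4 * Q + 2 * F + 4 * Q * F) * ϖ := by
  have hs2 : s ^ 2 ≤ 1 := pow_le_one₀ hs0 hs1
  have h1 : n * (s * δ) ≤ 1 := by
    calc n * (s * δ) = s * (n * δ) := by ring
      _ ≤ 1 * 1 := mul_le_mul hs1 hδ (by positivity) zero_le_one
      _ = 1 := one_mul 1
  have h2 : n * (s ^ 2 * δ) ≤ 1 := by
    calc n * (s ^ 2 * δ) = s ^ 2 * (n * δ) := by ring
      _ ≤ 1 * 1 := mul_le_mul hs2 hδ (by positivity) zero_le_one
      _ = 1 := one_mul 1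
  have h3 : n * (s ^ 2 * m) ≤ F * ϖ := by
    calc n * (s ^ 2 * m) ≤ n * (s ^ 2 * (F * H)) := by gcongr
      _ = F * ϖ := by rw [← hH]; ring
  have h4 : n * (s ^ 2 * (ℓ * m ^ 2)) ≤ F * ϖ := by
    calc n * (s ^ 2 * (ℓ * m ^ 2)) = ℓ * m * (n * (s ^ 2 * m)) := by ring
      _ ≤ 1 * (n * (s ^ 2 * m)) := by gcongr
      _ ≤ F * ϖ := by rw [one_mul]; exact h3
  have h5 := mul_le_mul_of_nonneg_left h3 hQ
  have h6 := mul_le_mul_of_nonneg_left (h2.trans hϖ) hQ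
  calc 2 * n * (s * δ + s ^ 2 * (ℓ * m ^ 2 + (m + δ) * (2 * Q)))
      = 2 * (n * (s * δ)) + 2 * (n * (s ^ 2 * (ℓ * m ^ 2))) + 4 * (Q * (n * (s ^ 2 * m))) +
          4 * (Q * (n * (s ^ 2 * δ))) := by ring
    _ ≤ 2 * ϖ + 2 * (F * ϖ) + 4 * (Q * (F * ϖ)) + 4 * (Q * ϖ) := by linarith
    _ = _ := by ring

/-- Deviation inequality for the kernel sums at a single point, with a polynomial bound. -/
theorem exists_pointwise_deviation (hD : 0 < D) {Ω : Type*} [MeasurableSpace Ω] {μ : Measure Ω}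
    [IsProbabilityMeasure μ] {S : Set 𝔼} {C : CSpace S} {X : ℕ → Ω → S}
    (hX : ∀ i, Measurable (X i)) (hstat : IsStrictlyStationary μ X) {b γ : ℝ} (hb : 0 < b)
    (hγ : 0 < γ) (hmix : IsGeomCMixing μ X C b γ ∨ IsGeomTimeReversedCMixing μ X C b γ)
    {K : 𝔼 → ℝ} (hK : KernelK1 K) (hK1 : ∫ u, K u = 1) {β : ℝ} (hβ : 0 < β)
    (hdecay : KernelDecay β K) {α p : ℝ} (hα : 0 < α) (hp : 1 ≤ p)
    (hK4 : KernelK4 C K (bandwidth D α p)) {F : ℝ} (hF0 : 0 ≤ F)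
    (hF : ∀ (h : ℝ) (x : 𝔼), 0 < h → ∫ ω, K (h⁻¹ • ((X 0 ω : 𝔼) - x)) ∂μ ≤ F * h ^ D) :
    ∃ G : ℝ, ∀ᶠ N : ℕ in atTop, ∀ (x : 𝔼) (A : ℝ), G ≤ A →
      μ.real {ω | 2 * (A * (N * (bandwidth D α p N ^ D * bandwidth D α p N ^ α))) ≤
        |∑ i ∈ Finset.range N, (K ((bandwidth D α p N)⁻¹ • ((X i ω : 𝔼) - x)) -
          ∫ ω', K ((bandwidth D α p N)⁻¹ • ((X 0 ω' : 𝔼) - x)) ∂μ)|} ≤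
        4 * (N : ℝ) ^ (-(A - G)) := by
  obtain ⟨ω₀⟩ : Nonempty Ω := nonempty_of_isProbabilityMeasure μ
  have : Nonempty S := ⟨X 0 ω₀⟩
  have hKm := hK.continuous.measurable
  have hνint : ∀ (h : ℝ) (x : 𝔼), ∫ z : S, K (h⁻¹ • ((z : 𝔼) - x)) ∂(μ.map (X 0)) =
      ∫ ω, K (h⁻¹ • ((X 0 ω : 𝔼) - x)) ∂μ := fun h x =>
    integral_map (hX 0).aemeasurable (Measurable.aestronglyMeasurable (by fun_prop))
  obtain ⟨A₀, c, hA₀, hc, hdom⟩ := hK4.exists_dominating hD hK hK1 hβ hdecay hα hp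
    (ν := μ.map (X 0)) hF0 (fun h x hh => by rw [hνint]; exact hF h x hh) (γ := γ) hb
  obtain ⟨κ, hκ, hK4⟩ := hK4
  obtain ⟨hK0, ⟨B, hB⟩, -⟩ := hK
  have hB0 : 0 ≤ B := (hK0 0).trans (hB 0)
  obtain ⟨ℓ, hℓ1, hℓlim, hℓδ⟩ := exists_block_length hb hγ hκ B
  obtain ⟨θ, hθ⟩ : ∃ θ : ℝ, θ = 1 / (2 * α + D) := ⟨_, rfl⟩
  have hθ0 : 0 < θ := by rw [hθ]; positivity
  have hsum := summable_exp_neg_mul_rpow hc hγ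
  obtain ⟨T₀, hT⟩ : ∃ T₀ : ℝ, T₀ = ∑' k : ℕ, Real.exp (-c * (k : ℝ) ^ γ) := ⟨_, rfl⟩
  have hT0 : 0 ≤ T₀ := by rw [hT]; exact tsum_nonneg fun _ => (Real.exp_pos _).le
  -- `T₀` bounds the summable part of `q`, and the `1` its constant part `N ^ (-c)` summed over a
  -- block. Adding `B` to `A₀` ensures `B ≤ q 0`.
  obtain ⟨Q, hQ⟩ : ∃ Q : ℝ, Q = (A₀ + B) * (T₀ + 1) := ⟨_, rfl⟩
  have hQ0 : 0 ≤ Q := by rw [hQ]; positivity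
  refine ⟨2 + 4 * Q + 2 * F + 4 * Q * F, ?_⟩
  have hev1 := (hℓlim c hc).eventually_le_const one_pos
  have hev2 := ((hℓlim 1 one_pos)).eventually_le_const one_pos
  have hev3 := ((hℓlim (3 / 4 * θ) (by positivity)).const_mul F).eventually_le_const
    (by rw [mul_zero]; exact one_pos)
  have hev4 := ((hℓlim (3 / 4 * θ * α) (by positivity)).const_mul B).eventually_le_const
    (by rw [mul_zero]; exact one_pos)
  filter_upwards [hdom, hK4, hℓδ, hev1, hev2, hev3, hev4, eventually_bandwidthBounds hD hα hp,
    eventually_gt_atTop 0] with N hdomN hKN hδN h1 h2 h3 h4 hbN hN x A hA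
  obtain ⟨hbN, -⟩ := hbN
  have hN0 : (0 : ℝ) < N := by exact_mod_cast hN
  have hle := hbN.le
  rw [← hθ] at hle
  have hmul := hbN.mul_eq
  have hpos := hbN.pos
  have hle1 := hbN.le_one
  have hlog : Real.log N ≤ Real.log N ^ p := by
    calc Real.log N = Real.log N ^ (1 : ℝ) := (Real.rpow_one _).symm
      _ ≤ Real.log N ^ p := Real.rpow_le_rpow_of_exponent_le hbN.one_le_log hp
  have hlog1 := hbN.one_le_log
  obtain ⟨hW, hsemi⟩ := hKN x
  have hdomx := hdomN x
  have hFh := hF _ x hpos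
  clear hdomN hKN hbN
  generalize bandwidth D α p N = h at *
  have hm0 : 0 ≤ ∫ ω, K (h⁻¹ • ((X 0 ω : 𝔼) - x)) ∂μ := integral_nonneg fun _ => hK0 _
  have hℓN : ℓ N ≤ N := by
    rw [Real.rpow_neg_one, ← div_eq_mul_inv, div_le_one hN0] at h2
    exact_mod_cast h2
  have hℓ0 : (0 : ℝ) ≤ ℓ N := Nat.cast_nonneg _
  have hs : h ^ α * (ℓ N * B) ≤ 1 := by
    calc h ^ α * (ℓ N * B) ≤ ((N : ℝ) ^ (-(3 / 4 * θ))) ^ α * (ℓ N * B) := by gcongr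
      _ = B * (ℓ N * (N : ℝ) ^ (-(3 / 4 * θ * α))) := by
        rw [← Real.rpow_mul hN0.le, neg_mul]
        ring
      _ ≤ 1 := h4
  have hℓm : ℓ N * ∫ ω, K (h⁻¹ • ((X 0 ω : 𝔼) - x)) ∂μ ≤ 1 := by
    have hhD : h ^ D ≤ h := pow_le_of_le_one hpos.le hle1 hD.ne'
    calc ℓ N * ∫ ω, K (h⁻¹ • ((X 0 ω : 𝔼) - x)) ∂μ
        ≤ ℓ N * (F * (N : ℝ) ^ (-(3 / 4 * θ))) := by
          refine mul_le_mul_of_nonneg_left (hFh.trans ?_) hℓ0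
          exact mul_le_mul_of_nonneg_left (hhD.trans hle) hF0
      _ = F * (ℓ N * (N : ℝ) ^ (-(3 / 4 * θ))) := by ring
      _ ≤ 1 := h3
  obtain ⟨q, hq⟩ : ∃ q : ℕ → ℝ, q = fun k : ℕ =>
    (A₀ + B) * (Real.exp (-c * (k : ℝ) ^ γ) + (N : ℝ) ^ (-c)) := ⟨_, rfl⟩
  have hqQ : ∑ k ∈ Finset.range (ℓ N), q k ≤ Q := by
    rw [hq, ← Finset.mul_sum, Finset.sum_add_distrib, Finset.sum_const, Finset.card_range,
      nsmul_eq_mul, hQ, hT]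
    have := hsum.sum_le_tsum (Finset.range (ℓ N)) fun k _ => (Real.exp_pos _).le
    gcongr
  obtain ⟨Y, hY, hYlaw, hYdec, hYsum⟩ := exists_pastDecoupled hX hstat hb hγ hmix N
  have hblock := hYdec.blockMixing hY hYlaw (hℓ1 N) (W := ⟨_, hW⟩) (B := B) (δ := 1 / N) (q := q)
    (fun z => hK0 _) (fun z => hB _)
    ((mul_le_mul_of_nonneg_left (C.cNorm_le (fun z => by
      rw [abs_of_nonneg (hK0 _)]; exact hB _) hsemi) (Real.exp_pos _).le).trans hδN)
    (fun k => by rw [hq]; positivity)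
    (by
      rw [hq]
      simp only [Nat.cast_zero, Real.zero_rpow hγ.ne', mul_zero, Real.exp_zero]
      have : 0 ≤ (N : ℝ) ^ (-c) := by positivity
      nlinarith)
    (fun k _ => by
      obtain ⟨a, e, g, ha, he, hWg, hle'⟩ := hdomx k
      refine ⟨a, e, g, ha, he, hWg, hle'.trans ?_⟩
      simp only [hq]
      exact mul_le_mul_of_nonneg_right (by linarith) (by positivity))
  simp only [hνint] at hblock
  have hdev := hblock.measure_abs_sum_ge_le (hℓ1 N) hℓN hqQ (Real.rpow_nonneg hpos.le α) hs
    (A * (N * (h ^ D * h ^ α)))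
  have hsums : ∀ ω, ∑ i ∈ Finset.range N, (K (h⁻¹ • ((Y i ω : 𝔼) - x)) -
      ∫ ω', K (h⁻¹ • ((X 0 ω' : 𝔼) - x)) ∂μ) = ∑ i ∈ Finset.range N,
        (K (h⁻¹ • ((X i ω : 𝔼) - x)) - ∫ ω', K (h⁻¹ • ((X 0 ω' : 𝔼) - x)) ∂μ) := fun ω =>
    hYsum (fun z => K (h⁻¹ • ((z : 𝔼) - x)) - ∫ ω', K (h⁻¹ • ((X 0 ω' : 𝔼) - x)) ∂μ) ω
  simp only [hsums] at hdev
  refine hdev.trans (mul_le_mul_of_nonneg_left ?_ (by norm_num))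
  rw [Real.rpow_def_of_pos hN0]
  refine Real.exp_le_exp.2 ?_
  have hexp := bernstein_exponent_le hN0.le (Real.rpow_nonneg hpos.le α)
    (Real.rpow_le_one hpos.le hle1 hα.le) (δ := 1 / N) (by positivity)
    (by rw [mul_one_div_cancel hN0.ne']) hm0 hFh hℓm hQ0 hmul (hlog1.trans hlog)
  -- The choice `s = h ^ α` makes the gain `s * a` and the variance cost both of order `(log N) ^
  -- p`, so a large `A` wins; `p ≥ 1` turns the exponential into a power of `N`.
  have hsa : h ^ α * (A * (N * (h ^ D * h ^ α))) = A * Real.log N ^ p := by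
    rw [← hmul]; ring
  rw [hsa]
  have hfin := mul_le_mul_of_nonneg_left hlog (sub_nonneg.2 hA)
  linarith

end Deviation

/-! ### From summable probabilities to stochastic orders -/

section Stochastic

theorem isBigO_of_measure_le {Ω : Type*} [MeasurableSpace Ω] {μ : Measure Ω}
    {Y : ℕ → Ω → ℝ≥0∞} {a : ℕ → ℝ} {A : ℝ} (hA : 0 < A)
    (h : ∀ᶠ N : ℕ in atTop, μ {ω | ENNReal.ofReal (A * a N) < Y N ω} ≤
      ENNReal.ofReal (4 * (N : ℝ) ^ (-2 : ℝ))) :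
    IsBigOAlmostSurely μ Y a ∧ IsBigOInProbability μ Y a := by
  have hsum : Summable fun N : ℕ => 4 * (N : ℝ) ^ (-2 : ℝ) :=
    (Real.summable_nat_rpow.2 (by norm_num)).mul_left 4
  refine ⟨⟨A, hA, ?_⟩, fun ε hε => ⟨A, hA, ?_⟩⟩
  · obtain ⟨N₀, hN₀⟩ := eventually_atTop.1 h
    have hae := ae_eventually_notMem (μ := μ)
      (s := fun N => {ω | N₀ ≤ N ∧ ENNReal.ofReal (A * a N) < Y N ω}) (by
        refine ne_top_of_le_ne_top hsum.tsum_ofReal_ne_top (ENNReal.tsum_le_tsum fun N => ?_)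
        by_cases hN : N₀ ≤ N
        · simpa [hN] using hN₀ N hN
        · simp [hN])
    filter_upwards [hae] with ω hω
    filter_upwards [hω, eventually_ge_atTop N₀] with N hN hN'
    by_contra hcon
    exact hN ⟨hN', not_le.1 hcon⟩
  · have ht : Tendsto (fun N : ℕ => ENNReal.ofReal (4 * (N : ℝ) ^ (-2 : ℝ))) atTop (𝓝 0) := by
      simpa using ENNReal.tendsto_ofReal hsum.tendsto_atTop_zero
    filter_upwards [h, ht.eventually_le_const hε] with N h1 h2
    exact h1.trans h2

end Stochastic

/-! ### Uniformity in the point of evaluation -/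

section Uniform

variable {D : ℕ}

local notation "𝔼" => EuclideanSpace ℝ (Fin D)

theorem EuclideanSpace.norm_le_card_mul {y : 𝔼} {ε : ℝ} (hε : 0 ≤ ε) (h : ∀ i, |y i| ≤ ε) :
    ‖y‖ ≤ D * ε := by
  rw [EuclideanSpace.norm_eq]
  refine Real.sqrt_le_iff.2 ⟨by positivity, ?_⟩
  calc ∑ i, ‖y i‖ ^ 2 ≤ ∑ _i : Fin D, ε ^ 2 :=
        Finset.sum_le_sum fun i _ => pow_le_pow_left₀ (norm_nonneg _) (h i) 2
    _ = D * ε ^ 2 := by simp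
    _ ≤ (D : ℝ) ^ 2 * ε ^ 2 := by
        refine mul_le_mul_of_nonneg_right ?_ (sq_nonneg ε)
        exact_mod_cast Nat.le_self_pow two_ne_zero D
    _ = (D * ε) ^ 2 := by ring

/-- A grid of polynomial size in a ball of polynomial radius. -/
theorem exists_grid {N : ℕ} (hN : 2 ≤ N) (w q : ℕ) :
    ∃ T : Finset 𝔼, T.card ≤ N ^ ((w + q + 2) * D) ∧
      ∀ x : 𝔼, ‖x‖ ≤ (N : ℝ) ^ q → ∃ y ∈ T, ‖x - y‖ ≤ D * ((N : ℝ) ^ w)⁻¹ := by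
  classical
  have hN0 : (0 : ℝ) < N := by exact_mod_cast (by omega : 0 < N)
  have hNw : (0 : ℝ) < (N : ℝ) ^ w := by positivity
  refine ⟨(Fintype.piFinset fun _ : Fin D =>
    Finset.Icc (-((N ^ (w + q) : ℕ) : ℤ)) ((N ^ (w + q) : ℕ) : ℤ)).image
      fun z => WithLp.toLp 2 fun i => (z i : ℝ) * ((N : ℝ) ^ w)⁻¹, ?_, fun x hx => ?_⟩
  · refine Finset.card_image_le.trans ?_
    rw [Fintype.card_piFinset, Finset.prod_const, Int.card_Icc, Finset.card_univ, Fintype.card_fin,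
      pow_mul]
    refine Nat.pow_le_pow_left ?_ D
    have h1 : 1 ≤ N ^ (w + q) := Nat.one_le_pow _ _ (by omega)
    have h2 : 4 ≤ N ^ 2 := by nlinarith
    have h3 := Nat.mul_le_mul_left (N ^ (w + q)) h2
    rw [← pow_add] at h3
    omega
  · refine ⟨_, Finset.mem_image_of_mem _ (a := fun i => ⌊x i * (N : ℝ) ^ w⌋) ?_, ?_⟩
    · refine Fintype.mem_piFinset.2 fun i => Finset.mem_Icc.2 ?_
      have h1 : |x i| ≤ (N : ℝ) ^ q := (PiLp.norm_apply_le x i).trans hx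
      have h2 : |x i * (N : ℝ) ^ w| ≤ (N : ℝ) ^ (w + q) := by
        rw [abs_mul, abs_of_pos hNw, pow_add, mul_comm]
        exact mul_le_mul_of_nonneg_left h1 hNw.le
      obtain ⟨h3, h4⟩ := abs_le.1 h2
      constructor
      · refine Int.le_floor.2 ?_
        push_cast
        exact h3
      · refine Int.floor_le_iff.2 ?_
        push_cast
        linarith
    · refine EuclideanSpace.norm_le_card_mul (by positivity) fun i => ?_
      have h1 := Int.floor_le (x i * (N : ℝ) ^ w)
      have h2 := (Int.lt_floor_add_one (x i * (N : ℝ) ^ w)).le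
      have h3 : (x - WithLp.toLp 2 fun i => (⌊x i * (N : ℝ) ^ w⌋ : ℝ) * ((N : ℝ) ^ w)⁻¹) i =
          (x i * (N : ℝ) ^ w - ⌊x i * (N : ℝ) ^ w⌋) * ((N : ℝ) ^ w)⁻¹ := by
        simp only [PiLp.sub_apply, sub_mul]
        rw [mul_inv_cancel_right₀ hNw.ne']
      rw [h3, abs_mul, abs_of_pos (inv_pos.2 hNw)]
      refine mul_le_of_le_one_left (by positivity) (abs_le.2 ⟨by linarith, by linarith⟩)

/-- Replacing the summands by uniformly close ones moves each term and its mean by at most `ε`. It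
is used both for passing to a grid point and, with `V = 0`, for points far from the data. -/
theorem abs_sum_sub_integral_le {Ω : Type*} [MeasurableSpace Ω] {μ : Measure Ω}
    [IsProbabilityMeasure μ] {U V : ℕ → Ω → ℝ} (hU : Integrable (U 0) μ) (hV : Integrable (V 0) μ)
    {ε : ℝ} (h : ∀ i ω, |U i ω - V i ω| ≤ ε) (N : ℕ) (ω : Ω) :
    |∑ i ∈ Finset.range N, (U i ω - ∫ ω', U 0 ω' ∂μ)| ≤
      |∑ i ∈ Finset.range N, (V i ω - ∫ ω', V 0 ω' ∂μ)| + N * (2 * ε) := by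
  have hm : |(∫ ω', U 0 ω' ∂μ) - ∫ ω', V 0 ω' ∂μ| ≤ ε := by
    rw [← integral_sub hU hV]
    have := norm_integral_le_of_norm_le_const (μ := μ) (f := fun ω => U 0 ω - V 0 ω)
      (ae_of_all _ fun ω => h 0 ω)
    simpa using this
  have h1 : ∑ i ∈ Finset.range N, (U i ω - ∫ ω', U 0 ω' ∂μ) =
      (∑ i ∈ Finset.range N, (V i ω - ∫ ω', V 0 ω' ∂μ)) + ∑ i ∈ Finset.range N,
        ((U i ω - V i ω) - ((∫ ω', U 0 ω' ∂μ) - ∫ ω', V 0 ω' ∂μ)) := by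
    rw [← Finset.sum_add_distrib]
    exact Finset.sum_congr rfl fun i _ => by ring
  rw [h1]
  refine (abs_add_le _ _).trans (add_le_add le_rfl ((Finset.abs_sum_le_sum_abs _ _).trans ?_))
  refine (Finset.sum_le_sum (g := fun _ => 2 * ε) fun i _ => ?_).trans_eq (by simp)
  refine (abs_sub _ _).trans ?_
  linarith [h i ω]

/-- The bandwidths are at least of the order of a negative power of `n`. -/
theorem BandwidthBounds.inv_pow_le (hD : 0 < D) {α p h : ℝ} {n : ℕ} (hα : 0 < α)
    (hb : BandwidthBounds D α p h n) (hn : 0 < n) :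
    ((n : ℝ) ^ (D + ⌈α⌉₊))⁻¹ ≤ h ^ D * h ^ α ∧ h⁻¹ ≤ n := by
  have hn1 : (1 : ℝ) ≤ n := by exact_mod_cast hn
  have hn0 : (0 : ℝ) < n := by linarith
  have hD' : (1 : ℝ) ≤ D := by exact_mod_cast hD
  have h1 : (n : ℝ)⁻¹ ≤ h := by
    refine le_trans ?_ hb.ge
    rw [← Real.rpow_neg_one]
    refine Real.rpow_le_rpow_of_exponent_le hn1 (neg_le_neg ?_)
    rw [div_le_one (by positivity)]
    linarith
  refine ⟨?_, (inv_le_comm₀ hb.pos hn0).2 h1⟩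
  rw [← inv_pow, pow_add]
  refine mul_le_mul (pow_le_pow_left₀ (by positivity) h1 D) ?_ (by positivity)
    (pow_nonneg hb.pos.le D)
  rw [← Real.rpow_natCast]
  exact (Real.rpow_le_rpow_of_exponent_ge (by positivity) (inv_le_one_of_one_le₀ hn1)
    (Nat.le_ceil α)).trans (Real.rpow_le_rpow (by positivity) h1 hα.le)

theorem integrable_kernel_comp {Ω : Type*} [MeasurableSpace Ω] {μ : Measure Ω}
    [IsProbabilityMeasure μ] {S : Set 𝔼} {Y : Ω → S} (hY : Measurable Y) {K : 𝔼 → ℝ}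
    (hK : KernelK1 K) (h : ℝ) (x : 𝔼) :
    Integrable (fun ω => K (h⁻¹ • ((Y ω : 𝔼) - x))) μ := by
  have hKm := hK.continuous.measurable
  obtain ⟨hK0, ⟨B, hB⟩, -⟩ := hK
  refine Integrable.of_bound (Measurable.aestronglyMeasurable (by fun_prop)) B
    (ae_of_all _ fun ω => ?_)
  rw [Real.norm_eq_abs, abs_of_nonneg (hK0 _)]
  exact hB _

/-- Uniform deviation of the kernel sums from their means, off a set of summable probability. -/
theorem exists_uniform_deviation (hD : 0 < D) {Ω : Type*} [MeasurableSpace Ω] {μ : Measure Ω}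
    [IsProbabilityMeasure μ] {S : Set 𝔼} (hS : Bornology.IsBounded S) {C : CSpace S}
    {X : ℕ → Ω → S} (hX : ∀ i, Measurable (X i)) (hstat : IsStrictlyStationary μ X) {b γ : ℝ}
    (hb : 0 < b) (hγ : 0 < γ)
    (hmix : IsGeomCMixing μ X C b γ ∨ IsGeomTimeReversedCMixing μ X C b γ)
    {K : 𝔼 → ℝ} (hK : KernelK1 K) (hK1 : ∫ u, K u = 1) {β : ℝ} (hβ : 0 < β)
    (hdecay : KernelDecay β K) {α p : ℝ} (hα : 0 < α) (hp : 1 ≤ p)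
    (hK4 : KernelK4 C K (bandwidth D α p)) {F : ℝ} (hF0 : 0 ≤ F)
    (hF : ∀ (h : ℝ) (x : 𝔼), 0 < h → ∫ ω, K (h⁻¹ • ((X 0 ω : 𝔼) - x)) ∂μ ≤ F * h ^ D) :
    ∃ A : ℝ, 0 < A ∧ ∀ᶠ N : ℕ in atTop,
      μ {ω | ¬ ∀ x : 𝔼, |∑ i ∈ Finset.range N, (K ((bandwidth D α p N)⁻¹ • ((X i ω : 𝔼) - x)) -
          ∫ ω', K ((bandwidth D α p N)⁻¹ • ((X 0 ω' : 𝔼) - x)) ∂μ)| ≤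
        A * (N * (bandwidth D α p N ^ D * bandwidth D α p N ^ α))} ≤
      ENNReal.ofReal (4 * (N : ℝ) ^ (-2 : ℝ)) := by
  obtain ⟨G, hG⟩ := exists_pointwise_deviation hD hX hstat hb hγ hmix hK hK1 hβ hdecay hα hp hK4
    hF0 hF
  obtain ⟨R, hR0, hSR⟩ : ∃ R : ℝ, 0 ≤ R ∧ ∀ z ∈ S, ‖z‖ ≤ R := by
    obtain ⟨R, hR⟩ := hS.exists_norm_le
    exact ⟨max R 0, le_max_right _ _, fun z hz => (hR z hz).trans (le_max_left _ _)⟩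
  have hint := fun (h : ℝ) (x : 𝔼) => integrable_kernel_comp (μ := μ) (hX 0) hK h x
  obtain ⟨hK0, ⟨B, hB⟩, ⟨l, hl⟩⟩ := hK
  obtain ⟨d, hd⟩ := hdecay
  have hd0 : 0 ≤ d := (mul_nonneg (hK0 0) (by positivity)).trans (hd 0)
  obtain ⟨v, hv⟩ : ∃ v : ℕ, v = D + ⌈α⌉₊ := ⟨_, rfl⟩
  -- Beyond radius `N ^ q` the decay of order `β` makes every kernel value at most of order `N ^
  -- (-v)`, hence of order `h ^ D * h ^ α`.
  obtain ⟨q, hq⟩ : ∃ q : ℕ, q = ⌈(v : ℝ) / β⌉₊ + 1 := ⟨_, rfl⟩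
  have hqv : (v : ℝ) ≤ q * β := by
    rw [← div_le_iff₀ hβ, hq]
    push_cast
    linarith [Nat.le_ceil ((v : ℝ) / β)]
  obtain ⟨E, hE⟩ : ∃ E : ℕ, E = (v + 1 + q + 2) * D := ⟨_, rfl⟩
  -- The grid has at most `N ^ E` points, so the union bound leaves a probability of order `N ^
  -- (-2)`.
  obtain ⟨A₁, hA₁⟩ : ∃ A₁ : ℝ, A₁ = |G| + E + 2 := ⟨_, rfl⟩
  have hA₁0 : 0 < A₁ := by rw [hA₁]; positivity
  refine ⟨2 * A₁ + 2 * (l * D) + 2 * (d * 2 ^ β), by positivity, ?_⟩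
  filter_upwards [hG, eventually_bandwidthBounds hD hα hp, eventually_ge_atTop 2,
    eventually_ge_atTop ⌈2 * R⌉₊] with N hGN hbN hN2 hNR
  obtain ⟨hbN, -⟩ := hbN
  obtain ⟨hinv, hinv'⟩ := hbN.inv_pow_le hD hα (by omega)
  rw [← hv] at hinv
  have hN1 : (1 : ℝ) ≤ N := by exact_mod_cast (by omega : 1 ≤ N)
  have hN0 : (0 : ℝ) < N := by linarith
  have hpos := hbN.pos
  have hle1 := hbN.le_one
  clear hbN
  generalize bandwidth D α p N = h at *
  obtain ⟨H, hH⟩ : ∃ H : ℝ, H = h ^ D * h ^ α := ⟨_, rfl⟩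
  have hH0 : 0 < H := by rw [hH]; positivity
  simp only [← hH] at hinv hGN ⊢
  -- The mesh exponent is `v + 1` because rescaling by `h⁻¹ ≤ N` costs one power of `N` in the
  -- Lipschitz estimate.
  obtain ⟨T, hTcard, hT⟩ := exists_grid (D := D) hN2 (v + 1) q
  rw [← hE] at hTcard
  have hsub : {ω | ¬ ∀ x : 𝔼, |∑ i ∈ Finset.range N, (K (h⁻¹ • ((X i ω : 𝔼) - x)) -
      ∫ ω', K (h⁻¹ • ((X 0 ω' : 𝔼) - x)) ∂μ)| ≤
        (2 * A₁ + 2 * (l * D) + 2 * (d * 2 ^ β)) * (N * H)} ⊆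
      ⋃ y ∈ T, {ω | 2 * (A₁ * (N * H)) ≤ |∑ i ∈ Finset.range N, (K (h⁻¹ • ((X i ω : 𝔼) - y)) -
        ∫ ω', K (h⁻¹ • ((X 0 ω' : 𝔼) - y)) ∂μ)|} := by
    intro ω hω
    by_contra hcon
    simp only [Set.mem_iUnion, Set.mem_ofPred_eq, not_exists, not_le] at hcon
    refine hω fun x => ?_
    have hp1 : 0 ≤ A₁ * (N * H) := by positivity
    have hp2 : 0 ≤ l * D * (N * H) := by positivity
    have hp3 : 0 ≤ d * 2 ^ β * (N * H) := by positivity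
    by_cases hx : ‖x‖ ≤ (N : ℝ) ^ q
    · obtain ⟨y, hyT, hy⟩ := hT x hx
      have hdiff : ∀ i ω, |K (h⁻¹ • ((X i ω : 𝔼) - x)) - K (h⁻¹ • ((X i ω : 𝔼) - y))| ≤
          l * D * H := by
        intro i ω
        have h1 := hl.dist_le_mul (h⁻¹ • ((X i ω : 𝔼) - x)) (h⁻¹ • ((X i ω : 𝔼) - y))
        rw [Real.dist_eq, dist_eq_norm, ← smul_sub, sub_sub_sub_cancel_left, norm_smul,
          Real.norm_eq_abs, abs_of_pos (inv_pos.2 hpos), norm_sub_rev] at h1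
        refine h1.trans ?_
        rw [mul_assoc]
        refine mul_le_mul_of_nonneg_left ?_ l.2
        calc h⁻¹ * ‖x - y‖ ≤ N * (D * ((N : ℝ) ^ (v + 1))⁻¹) := by gcongr
          _ = D * ((N : ℝ) ^ v)⁻¹ := by rw [pow_succ]; field_simp
          _ ≤ D * H := by gcongr
      have h2 := abs_sum_sub_integral_le (μ := μ) (hint h x) (hint h y) hdiff N ω
      have h3 := hcon y hyT
      linarith
    · push Not at hx
      have hsmall : ∀ i ω, |K (h⁻¹ • ((X i ω : 𝔼) - x)) - 0| ≤ d * 2 ^ β * H := by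
        intro i ω
        rw [sub_zero, abs_of_nonneg (hK0 _)]
        have hN2R : 2 * R ≤ (N : ℝ) ^ q := by
          refine (Nat.ceil_le.1 hNR).trans ?_
          exact le_self_pow₀ hN1 (by omega)
        have h1 : (N : ℝ) ^ q / 2 ≤ ‖h⁻¹ • ((X i ω : 𝔼) - x)‖ := by
          have h2 := norm_sub_norm_le x (X i ω : 𝔼)
          have h3 := hSR _ (X i ω).2
          rw [norm_smul, Real.norm_eq_abs, abs_of_pos (inv_pos.2 hpos), norm_sub_rev]
          have h4 : 1 ≤ h⁻¹ := (one_le_inv₀ hpos).2 hle1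
          have h5 := le_mul_of_one_le_left (norm_nonneg (x - (X i ω : 𝔼))) h4
          linarith
        have h2 : K (h⁻¹ • ((X i ω : 𝔼) - x)) * ((N : ℝ) ^ q / 2) ^ β ≤ d := by
          refine le_trans ?_ (hd (h⁻¹ • ((X i ω : 𝔼) - x)))
          exact mul_le_mul_of_nonneg_left (Real.rpow_le_rpow (by positivity) h1 hβ.le) (hK0 _)
        have h3 : (N : ℝ) ^ v ≤ ((N : ℝ) ^ q) ^ β := by
          rw [← Real.rpow_natCast, ← Real.rpow_natCast, ← Real.rpow_mul hN0.le]
          exact Real.rpow_le_rpow_of_exponent_le hN1 hqv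
        rw [Real.div_rpow (by positivity) two_pos.le] at h2
        have h4 : K (h⁻¹ • ((X i ω : 𝔼) - x)) ≤ d * 2 ^ β * (((N : ℝ) ^ q) ^ β)⁻¹ := by
          rw [← div_eq_mul_inv, le_div_iff₀ (by positivity)]
          rw [← mul_div_assoc, div_le_iff₀ (by positivity)] at h2
          exact h2
        refine h4.trans (mul_le_mul_of_nonneg_left (le_trans ?_ hinv) (by positivity))
        gcongr
      have h2 := abs_sum_sub_integral_le (μ := μ) (V := fun _ _ => 0) (hint h x)
        (integrable_zero _ _ _) hsmall N ω
      simp only [integral_zero, sub_zero, Finset.sum_const_zero, abs_zero, zero_add] at h2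
      linarith
  refine (measure_mono hsub).trans ((measure_biUnion_finset_le _ _).trans ?_)
  have hterm : ∀ y ∈ T, μ {ω | 2 * (A₁ * (N * H)) ≤
      |∑ i ∈ Finset.range N, (K (h⁻¹ • ((X i ω : 𝔼) - y)) -
        ∫ ω', K (h⁻¹ • ((X 0 ω' : 𝔼) - y)) ∂μ)|} ≤
      ENNReal.ofReal (4 * (N : ℝ) ^ (-(E + 2 : ℝ))) := by
    intro y _
    rw [← ofReal_measureReal]
    refine ENNReal.ofReal_le_ofReal ((hGN y A₁ ?_).trans ?_)
    · rw [hA₁]; linarith [le_abs_self G, (Nat.cast_nonneg E : (0 : ℝ) ≤ E)]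
    · refine mul_le_mul_of_nonneg_left (Real.rpow_le_rpow_of_exponent_le hN1 ?_) (by norm_num)
      rw [hA₁]
      linarith [le_abs_self G]
  refine (Finset.sum_le_sum hterm).trans ?_
  rw [Finset.sum_const, nsmul_eq_mul, ← ENNReal.ofReal_natCast, ← ENNReal.ofReal_mul (by positivity)]
  refine ENNReal.ofReal_le_ofReal ?_
  have hcard : (T.card : ℝ) ≤ (N : ℝ) ^ (E : ℝ) := by
    rw [Real.rpow_natCast]
    exact_mod_cast hTcard
  calc (T.card : ℝ) * (4 * (N : ℝ) ^ (-(E + 2 : ℝ)))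
      ≤ (N : ℝ) ^ (E : ℝ) * (4 * (N : ℝ) ^ (-(E + 2 : ℝ))) := by gcongr
    _ = 4 * (N : ℝ) ^ (-2 : ℝ) := by
      rw [mul_left_comm, ← Real.rpow_add hN0]
      congr 2
      ring

/-- Uniform convergence rates on the sets `T N` on which the bias is controlled. -/
theorem estimationError_isBigO (hD : 0 < D) {Ω : Type*} [MeasurableSpace Ω] {μ : Measure Ω}
    [IsProbabilityMeasure μ] {S : Set 𝔼} (hS : Bornology.IsBounded S) {C : CSpace S}
    {X : ℕ → Ω → S} (hX : ∀ i, Measurable (X i)) (hstat : IsStrictlyStationary μ X) {b γ : ℝ}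
    (hb : 0 < b) (hγ : 0 < γ)
    (hmix : IsGeomCMixing μ X C b γ ∨ IsGeomTimeReversedCMixing μ X C b γ)
    {f : 𝔼 → ℝ} (hf : IsDensityOf μ (fun ω => (X 0 ω : 𝔼)) f) (hfb : ∃ F : ℝ, ∀ᵐ x, f x ≤ F)
    {K : 𝔼 → ℝ} (hK : KernelK1 K) (hK1 : ∫ u, K u = 1) {β : ℝ} (hβ : 0 < β)
    (hdecay : KernelDecay β K) {α p : ℝ} (hα : 0 < α) (hp : 1 ≤ p)
    (hK4 : KernelK4 C K (bandwidth D α p)) (T : ℕ → Set 𝔼)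
    (hbias : ∃ A : ℝ, ∀ᶠ N : ℕ in atTop, 0 < bandwidth D α p N → ∀ x ∈ T N,
      |(∫ u, K u * f (x + bandwidth D α p N • u)) - f x| ≤ A * bandwidth D α p N ^ α) :
    IsBigOAlmostSurely μ
      (fun N ω => supNormOn (T N) (estimationError X K f (bandwidth D α p) N ω)) (rate D α p) ∧
    IsBigOInProbability μ
      (fun N ω => supNormOn (T N) (estimationError X K f (bandwidth D α p) N ω)) (rate D α p) := by
  have hX0 : Measurable fun ω => (X 0 ω : 𝔼) := measurable_subtype_coe.comp (hX 0)
  obtain ⟨F, hF⟩ := hfb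
  obtain ⟨A, hA, hdev⟩ := exists_uniform_deviation hD hS hX hstat hb hγ hmix hK hK1 hβ hdecay hα hp
    hK4 (F := max F 0) (le_max_right _ _) fun h x hh => hf.integral_kernel_le hX0 hK hK1
      (hF.mono fun x hx => hx.trans (le_max_left F 0)) hh x
  obtain ⟨A', hbias⟩ := hbias
  refine isBigO_of_measure_le (A := A + |A'|) (by positivity) ?_
  filter_upwards [hdev, hbias, eventually_bandwidthBounds hD hα hp, eventually_gt_atTop 0] with
    N hN hbN hbb hN0
  obtain ⟨hbb, hrate⟩ := hbb
  refine (measure_mono fun ω hω hall => ?_).trans hN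
  refine absurd hω (not_lt.2 (iSup₂_le fun x hx => ENNReal.ofReal_le_ofReal ?_))
  have hpos := hbb.pos
  have hbx := hbN hpos x hx
  have hdx := hall x
  rw [hf.integral_kernel hX0 hK hpos] at hdx
  rw [hrate, estimationError, kernelDensityEstimator]
  have hN0' : (0 : ℝ) < N := by exact_mod_cast hN0
  generalize bandwidth D α p N = h at *
  rw [Finset.sum_sub_distrib, Finset.sum_const, Finset.card_range, nsmul_eq_mul] at hdx
  generalize ∑ i ∈ Finset.range N, K (h⁻¹ • ((X i ω : 𝔼) - x)) = s at *
  generalize ∫ u, K u * f (x + h • u) = m at *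
  have hNh : 0 < (N : ℝ) * h ^ D := by positivity
  have h1 : |((N : ℝ) * h ^ D)⁻¹ * s - m| ≤ A * h ^ α := by
    have h2 : ((N : ℝ) * h ^ D)⁻¹ * s - m = ((N : ℝ) * h ^ D)⁻¹ * (s - N * (h ^ D * m)) := by
      field_simp
    rw [h2, abs_mul, abs_of_pos (inv_pos.2 hNh), inv_mul_le_iff₀ hNh]
    refine hdx.trans_eq ?_
    ring
  have h3 : 0 ≤ h ^ α := by positivity
  calc |((N : ℝ) * h ^ D)⁻¹ * s - f x|
      ≤ |((N : ℝ) * h ^ D)⁻¹ * s - m| + |m - f x| := abs_sub_le _ _ _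
    _ ≤ A * h ^ α + A' * h ^ α := add_le_add h1 hbx
    _ ≤ A * h ^ α + |A'| * h ^ α := by gcongr; exact le_abs_self A'
    _ = (A + |A'|) * h ^ α := by ring

end Uniform

/-! ### The convergence rates -/

theorem mainTheorem6 {D : ℕ} (hD : 0 < D)
    {Ω : Type*} [MeasurableSpace Ω] (μ : Measure Ω) [IsProbabilityMeasure μ]
    (S : Set (EuclideanSpace ℝ (Fin D))) (hS : Bornology.IsBounded S)
    (C : CSpace S) (hC1 : C.ExpStable) (hC2 : C.ConstNull)
    (X : ℕ → Ω → S) (hX : ∀ i, Measurable (X i)) (hstat : IsStrictlyStationary μ X)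
    (b γ : ℝ) (hb : 0 < b) (hγ : 0 < γ)
    (hmix : IsGeomCMixing μ X C b γ ∨ IsGeomTimeReversedCMixing μ X C b γ)
    (f : EuclideanSpace ℝ (Fin D) → ℝ)
    (hf : IsDensityOf μ (fun ω => (X 0 ω : EuclideanSpace ℝ (Fin D))) f)
    (α : ℝ) (hα : 0 < α)
    (K : EuclideanSpace ℝ (Fin D) → ℝ) (hK1 : KernelK1 K) :
    -- Hölder continuous density
    (KernelK2 α K → IsHolder α f →
      (KernelK4 C K (bandwidth D α ((γ + 1) / γ)) →
        IsBigOAlmostSurely μ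
          (fun N ω => supNormOn Set.univ
            (estimationError X K f (bandwidth D α ((γ + 1) / γ)) N ω))
          (rate D α ((γ + 1) / γ))) ∧
      (1 < γ → KernelK4 C K (bandwidth D α 1) →
        IsBigOInProbability μ
          (fun N ω => supNormOn Set.univ (estimationError X K f (bandwidth D α 1) N ω))
          (rate D α 1))) ∧
    -- pointwise Hölder controllable density
    (∀ (M : ℝ) (c r : EuclideanSpace ℝ (Fin D) → ℝ), 0 < M → KernelK3 M K → ∫ u, K u = 1 →
      (∃ B : ℝ, ∀ᵐ x, f x ≤ B) →
      IsPointwiseHolderControllable α f c r → (∀ x ∈ S, HolderControlAt α f c r x) →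
      (KernelK4 C K (bandwidth D α ((γ + 1) / γ)) →
        ControlConstantBounded S c r M (bandwidth D α ((γ + 1) / γ)) →
        IsBigOAlmostSurely μ
          (fun N ω => supNormOn (controlledPart S r (bandwidth D α ((γ + 1) / γ) N * M))
            (estimationError X K f (bandwidth D α ((γ + 1) / γ)) N ω))
          (rate D α ((γ + 1) / γ))) ∧
      (1 < γ → KernelK4 C K (bandwidth D α 1) →
        ControlConstantBounded S c r M (bandwidth D α 1) →
        IsBigOInProbability μ
          (fun N ω => supNormOn (controlledPart S r (bandwidth D α 1 N * M))
            (estimationError X K f (bandwidth D α 1) N ω))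
          (rate D α 1))) := by
  have hX0 : Measurable fun ω => (X 0 ω : EuclideanSpace ℝ (Fin D)) :=
    measurable_subtype_coe.comp (hX 0)
  have hp : 1 ≤ (γ + 1) / γ := by rw [le_div_iff₀ hγ]; linarith
  refine ⟨fun hK2 hfH => ?_, fun M c r hM hK3 hKint hfb _ hctrl => ?_⟩
  · obtain ⟨F, hF⟩ := hfH.bounded hα hf hX0
    obtain ⟨A, hA⟩ := hfH.exists_bias_le hf.1 hK1 hK2
    have main := fun (p : ℝ) (hp : 1 ≤ p) (hK4 : KernelK4 C K (bandwidth D α p)) =>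
      estimationError_isBigO hD hS hX hstat hb hγ hmix hf ⟨F, ae_of_all _ hF⟩ hK1 hK2.2
        (by positivity : 0 < α / (D + 1)) (hK2.kernelDecay hα hK1) hα hp hK4 (fun _ => Set.univ)
        ⟨A, Eventually.of_forall fun N hpos x _ => hA _ x hpos⟩
    exact ⟨fun hK4 => (main _ hp hK4).1, fun _ hK4 => (main 1 le_rfl hK4).2⟩
  · have main := fun (p : ℝ) (hp : 1 ≤ p) (hK4 : KernelK4 C K (bandwidth D α p))
        (hc : ControlConstantBounded S c r M (bandwidth D α p)) =>
      estimationError_isBigO hD hS hX hstat hb hγ hmix hf hfb hK1 hKint one_pos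
        (hK3.kernelDecay hK1) hα hp hK4 (fun N => controlledPart S r (bandwidth D α p N * M)) (by
          obtain ⟨B, hB⟩ := hc
          refine ⟨B * M ^ α, hB.mono fun N hBN hpos x hx => ?_⟩
          -- Controlled points lie in `S`, at distance zero from it, so membership in the
          -- enlargement is automatic.
          have hcx := hBN x ⟨hx, by
            rw [enlargement, Set.mem_ofPred_eq, Metric.infDist_zero_of_mem hx.1]
            positivity⟩
          refine ((hctrl x hx.1).bias_le hα hf.1 hK1 hK3 hKint hpos hx.2).trans ?_
          gcongr)
    exact ⟨fun hK4 hc => (main _ hp hK4 hc).1, fun _ hK4 hc => (main 1 le_rfl hK4 hc).2⟩
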